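/- Let $c,m,\alpha>0$ and let $0\le Z<Z_c:=\dfrac{2}{(\frac{\pi}{2}+\frac{2}{\pi})\,\alpha}$. Put $e(p)=\sqrt{c^2p^2+m^2c^4}$ and $n(p)=[2e(p)(e(p)+e(0))]^{1/2}$, and let $Q_l(t)=2^{-l-1}\int_{-1}^{1}(1-x^2)^l(t-x)^{-l-1}\,dx$ $(t>1)$ be the Legendre functions of the second kind. For $l\in\{0,1,2,\dots\}$ and $s=\pm\frac12$ with $(l,s)\ne(0,-\frac12)$ (the pairs that occur in the partial wave decomposition) let $$k_{l,s}(p',p)=\frac{[e(p')+e(0)]\,Q_l\!\left(\tfrac12\left[\tfrac{p'}{p}+\tfrac{p}{p'}\right]\right)[e(p)+e(0)]+c^2p'\,Q_{l+2s}\!\left(\tfrac12\left[\tfrac{p'}{p}+\tfrac{p}{p'}\right]\right)p}{n(p')\,n(p)}$$ and let $\beta_{l,s}$ be the sesquilinear form $$\beta_{l,s}[v,u]=\int_0^\infty e(p)\,\overline{v(p)}\,u(p)\,dp-\frac{\alpha cZ}{\pi}\int_0^\infty\!\!\int_0^\infty\overline{v(p')}\,k_{l,s}(p',p)\,u(p)\,dp'\,dp$$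 with domain $\mathcal D=L^2(0,\infty;\sqrt{1+p^2}\,dp)$. Let $b_{l,s}$ be the operator in $L^2(0,\infty)$ associated with $\beta_{l,s}$: $u\in D(b_{l,s})$ and $b_{l,s}u=w$ if and only if $u\in\mathcal D$, $w\in L^2(0,\infty)$ and $\beta_{l,s}[v,u]=(v,w)_{L^2(0,\infty)}$ for all $v\in\mathcal D$. Then: 1. if $(l,s)\ne(1,-\frac12)$, then $b_{l,s}$ has no eigenvalues in $[mc^2,\infty)$; 2. $b_{1,-1/2}$ has no eigenvalues in $[\max\{1,\,2\alpha Z-\frac12\}\,mc^2,\infty)$; 3. in particular, if $Z\le\dfrac{3}{4\alpha}$, then $b_{1,-1/2}$ has no eigenvalues in $[mc^2,\infty)$. -/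

import Mathlib

namespace BrownRavenhall

open MeasureTheory Set

/-- Lebesgue measure on the half-line `(0, ∞)` of radial momenta. -/
noncomputable abbrev halfLine : Measure ℝ := volume.restrict (Ioi 0)

/-- The complex Hilbert space `L²(0, ∞)`. -/
abbrev RadialL2 : Type := Lp ℂ 2 halfLine

/-- The two spin labels `s = 1/2` (`up`) and `s = -1/2` (`down`). -/
inductive Spin where
  | up : Spin
  | down : Spin

/-- The index `l + 2 s`. The truncated subtraction is only met at `(l, s) = (0, -1/2)`, a pair that
does not occur in the partial wave decomposition (there are no spherical spinors for it). -/
def Spin.shift : Spin → ℕ → ℕ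
  | .up, l => l + 1
  | .down, l => l - 1

/-- The Legendre function of the second kind `Q_l(t)`, `t > 1`, by its classical integral
`Q_l(t) = 2^{-(l+1)} ∫_{-1}^{1} (1 - x²)^l (t - x)^{-(l+1)} dx`. -/
noncomputable def legendreQ (l : ℕ) (t : ℝ) : ℝ :=
  (1 / 2) ^ (l + 1) * ∫ x in (-1 : ℝ)..1, (1 - x ^ 2) ^ l / (t - x) ^ (l + 1)

/-- The relativistic energy `e(p) = √(c² p² + m² c⁴)`. -/
noncomputable def energy (c m p : ℝ) : ℝ := √(c ^ 2 * p ^ 2 + m ^ 2 * c ^ 4)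

/-- The normalisation `n(p) = [2 e(p) (e(p) + e(0))]^{1/2}`. -/
noncomputable def normFactor (c m p : ℝ) : ℝ :=
  √(2 * energy c m p * (energy c m p + energy c m 0))

/-- The partial wave kernel `k_{l,s}(p', p)`. -/
noncomputable def kernel (c m : ℝ) (l : ℕ) (s : Spin) (p' p : ℝ) : ℝ :=
  (energy c m p' + energy c m 0) * legendreQ l ((p' / p + p / p') / 2)
      * (energy c m p + energy c m 0) / (normFactor c m p' * normFactor c m p)
    + c ^ 2 * p' * legendreQ (s.shift l) ((p' / p + p / p') / 2) * p
      / (normFactor c m p' * normFactor c m p)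

/-- The partial wave form
`β_{l,s}[v, u] = ∫ e(p) v̄(p) u(p) dp - (α c Z / π) ∬ v̄(p') k_{l,s}(p', p) u(p) dp' dp`. -/
noncomputable def form (c m α Z : ℝ) (l : ℕ) (s : Spin) (v u : ℝ → ℂ) : ℂ :=
  (∫ p, (energy c m p : ℂ) * (starRingEnd ℂ (v p) * u p) ∂halfLine)
    - ((α * c * Z / Real.pi : ℝ) : ℂ) *
      ∫ q : ℝ × ℝ, starRingEnd ℂ (v q.1) * (kernel c m l s q.1 q.2 : ℂ) * u q.2
        ∂(halfLine.prod halfLine)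

/-! ### The form domain `L²(0, ∞; √(1 + p²) dp)` -/

theorem two_mul_le_sq (a b : ℝ) : a * b ≤ (a ^ 2 + b ^ 2) / 2 := by
  nlinarith [sq_nonneg (a - b)]

/-- The form domain: those `u ∈ L²(0, ∞)` with `∫ √(1 + p²) |u(p)|² dp < ∞`. -/
noncomputable def formDomain : Submodule ℂ RadialL2 where
  carrier := {u | Integrable (fun p => √(1 + p ^ 2) * ‖u p‖ ^ 2) halfLine}
  zero_mem' := by
    refine (integrable_zero ℝ ℝ halfLine).congr ?_
    filter_upwards [Lp.coeFn_zero ℂ 2 halfLine] with p hp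
    rw [hp]
    simp
  add_mem' := by
    intro u v hu hv
    refine ((hu.add hv).const_mul 2).mono' ?_ ?_
    · exact (by fun_prop : Measurable fun p : ℝ => √(1 + p ^ 2)).aestronglyMeasurable.mul
        ((Lp.aestronglyMeasurable (u + v)).norm.pow 2)
    · filter_upwards [Lp.coeFn_add u v] with p hp
      have h1 : ‖(u + v : RadialL2) p‖ ^ 2 ≤ 2 * (‖u p‖ ^ 2 + ‖v p‖ ^ 2) := by
        rw [hp, Pi.add_apply]
        have := norm_add_le (u p) (v p)
        have h0 := norm_nonneg (u p + v p)
        nlinarith [sq_nonneg (‖u p‖ - ‖v p‖)]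
      rw [Real.norm_of_nonneg (by positivity)]
      have := mul_le_mul_of_nonneg_left h1 (Real.sqrt_nonneg (1 + p ^ 2))
      simp only [Pi.add_apply]
      linarith
  smul_mem' := by
    intro a u hu
    refine (hu.const_mul (‖a‖ ^ 2)).congr ?_
    filter_upwards [Lp.coeFn_smul a u] with p hp
    simp only [hp, Pi.smul_apply, norm_smul]
    ring

/-- The form domain is dense, in the form needed below: only `0` is orthogonal to it. -/
theorem eq_zero_of_forall_inner_eq_zero (w : RadialL2)
    (h : ∀ v ∈ formDomain, inner ℂ v w = 0) : w = 0 := by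
  have hmeas : Measurable fun p : ℝ => (((1 + p ^ 2)⁻¹ : ℝ) : ℂ) := by fun_prop
  have hsm : AEStronglyMeasurable (fun p : ℝ => (((1 + p ^ 2)⁻¹ : ℝ) : ℂ) * w p) halfLine :=
    hmeas.aestronglyMeasurable.mul (Lp.aestronglyMeasurable w)
  have hle : ∀ p : ℝ, (1 + p ^ 2)⁻¹ ≤ 1 := fun p => inv_le_one_of_one_le₀ (by nlinarith [sq_nonneg p])
  have hmem : MemLp (fun p : ℝ => (((1 + p ^ 2)⁻¹ : ℝ) : ℂ) * w p) 2 halfLine := by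
    refine (Lp.memLp w).of_le hsm (Filter.Eventually.of_forall fun p => ?_)
    rw [norm_mul, Complex.norm_real, Real.norm_of_nonneg (by positivity)]
    exact mul_le_of_le_one_left (norm_nonneg _) (hle p)
  have hv : hmem.toLp _ ∈ formDomain := by
    have hi : Integrable (fun p => ‖w p‖ ^ 2) halfLine :=
      (Lp.memLp w).integrable_norm_pow (by norm_num)
    refine hi.mono' ?_ ?_
    · exact (by fun_prop : Measurable fun p : ℝ => √(1 + p ^ 2)).aestronglyMeasurable.mul
        ((Lp.aestronglyMeasurable _).norm.pow 2)
    · filter_upwards [hmem.coeFn_toLp] with p hp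
      rw [Real.norm_of_nonneg (by positivity), hp, norm_mul, Complex.norm_real,
        Real.norm_of_nonneg (by positivity), mul_pow, ← mul_assoc]
      refine mul_le_of_le_one_left (by positivity) ?_
      have h1 : √(1 + p ^ 2) ≤ 1 + p ^ 2 := by
        rw [Real.sqrt_le_left (by positivity)]
        nlinarith [sq_nonneg p]
      calc √(1 + p ^ 2) * (1 + p ^ 2)⁻¹ ^ 2 ≤ (1 + p ^ 2) * (1 + p ^ 2)⁻¹ ^ 2 := by gcongr
        _ = (1 + p ^ 2)⁻¹ := by field_simp
        _ ≤ 1 := hle p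
  have h0 := h _ hv
  rw [L2.inner_def] at h0
  have h1 : ∫ p, (1 + p ^ 2)⁻¹ * ‖w p‖ ^ 2 ∂halfLine = 0 := by
    have : ((∫ p, (1 + p ^ 2)⁻¹ * ‖w p‖ ^ 2 ∂halfLine : ℝ) : ℂ) = 0 := by
      rw [← h0, ← integral_complex_ofReal]
      refine integral_congr_ae ?_
      filter_upwards [hmem.coeFn_toLp] with p hp
      rw [hp, RCLike.inner_apply, map_mul, Complex.conj_ofReal]
      have := Complex.mul_conj' (w p)
      push_cast
      rw [← this]
      ring
    exact_mod_cast this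
  rw [integral_eq_zero_iff_of_nonneg (fun p => by positivity)] at h1
  · refine Lp.ext ?_
    filter_upwards [h1, Lp.coeFn_zero ℂ 2 halfLine] with p hp hz
    rw [hz]
    have h2 : (1 + p ^ 2)⁻¹ ≠ 0 := by positivity
    simpa [h2] using hp
  · refine ((Lp.memLp w).integrable_norm_pow (p := 2) (by norm_num)).mono' ?_ ?_
    · exact (by fun_prop : Measurable fun p : ℝ => (1 + p ^ 2)⁻¹).aestronglyMeasurable.mul
        ((Lp.aestronglyMeasurable _).norm.pow 2)
    · refine Filter.Eventually.of_forall fun p => ?_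
      rw [Real.norm_of_nonneg (by positivity)]
      exact mul_le_of_le_one_left (by positivity) (hle p)

/-! ### Convergence of the form integrals on the form domain -/

theorem measurable_legendreQ (l : ℕ) : Measurable (legendreQ l) := by
  unfold legendreQ
  refine Measurable.const_mul ?_ _
  simp only [intervalIntegral.integral_of_le (show (-1 : ℝ) ≤ 1 by norm_num)]
  have : StronglyMeasurable
      (Function.uncurry fun t x : ℝ => (1 - x ^ 2) ^ l / (t - x) ^ (l + 1)) :=
    (by unfold Function.uncurry; fun_prop : Measurable
      (Function.uncurry fun t x : ℝ => (1 - x ^ 2) ^ l / (t - x) ^ (l + 1))).stronglyMeasurable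
  exact this.integral_prod_right.measurable

theorem exists_legendreQ_bound : ∃ C : ℝ, 0 ≤ C ∧ ∀ (l : ℕ) (t : ℝ), 1 < t →
    |legendreQ l t| ≤ C * (t - 1) ^ (-(1 / 4) : ℝ) := by
  have hint : IntervalIntegrable (fun x : ℝ => (1 - x) ^ (-(3 / 4) : ℝ)) volume (-1) 1 := by
    have := (intervalIntegral.intervalIntegrable_rpow' (a := 2) (b := 0)
      (show (-1 : ℝ) < -(3 / 4) by norm_num)).comp_sub_left 1
    norm_num at this
    exact this
  refine ⟨∫ x in (-1 : ℝ)..1, (1 - x) ^ (-(3 / 4) : ℝ), ?_, ?_⟩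
  · refine intervalIntegral.integral_nonneg (by norm_num) fun x hx => ?_
    exact Real.rpow_nonneg (by linarith [hx.2]) _
  intro l t ht
  have hb : ‖∫ x in (-1 : ℝ)..1, (1 - x ^ 2) ^ l / (t - x) ^ (l + 1)‖
      ≤ ∫ x in (-1 : ℝ)..1, (2 ^ l * (t - 1) ^ (-(1 / 4) : ℝ)) * (1 - x) ^ (-(3 / 4) : ℝ) := by
    refine intervalIntegral.norm_integral_le_of_norm_le (by norm_num) ?_ (hint.const_mul _)
    have hne : ∀ᵐ x : ℝ ∂volume, x ≠ 1 := compl_mem_ae_iff.2 (measure_singleton 1)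
    filter_upwards [hne] with x hx1 hx
    have hx2 : 0 < 1 - x := by
      rcases lt_or_eq_of_le hx.2 with h | h
      · linarith
      · exact absurd h hx1
    have htx : 0 < t - x := by linarith
    have hn : 0 ≤ 1 - x ^ 2 := by nlinarith [hx.1]
    rw [Real.norm_of_nonneg (by positivity)]
    have h1 : (1 - x ^ 2) ^ l ≤ 2 ^ l * (t - x) ^ l := by
      rw [← mul_pow]
      exact pow_le_pow_left₀ hn (by nlinarith [hx.1]) l
    have h2 : (t - x) ^ (-1 : ℝ) ≤ (t - 1) ^ (-(1 / 4) : ℝ) * (1 - x) ^ (-(3 / 4) : ℝ) := by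
      rw [show (-1 : ℝ) = -(1 / 4) + -(3 / 4) by norm_num, Real.rpow_add htx]
      refine mul_le_mul ?_ ?_ (by positivity) (Real.rpow_nonneg (by linarith) _)
      · exact Real.rpow_le_rpow_of_nonpos (by linarith) (by linarith) (by norm_num)
      · exact Real.rpow_le_rpow_of_nonpos hx2 (by linarith) (by norm_num)
    calc (1 - x ^ 2) ^ l / (t - x) ^ (l + 1) ≤ 2 ^ l * (t - x) ^ l / (t - x) ^ (l + 1) := by gcongr
      _ = 2 ^ l * (t - x) ^ (-1 : ℝ) := by
        rw [Real.rpow_neg_one, pow_succ]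
        field_simp
      _ ≤ _ := by
        rw [mul_assoc]
        gcongr
  rw [intervalIntegral.integral_const_mul] at hb
  have hI : 0 ≤ ∫ x in (-1 : ℝ)..1, (1 - x) ^ (-(3 / 4) : ℝ) :=
    intervalIntegral.integral_nonneg (by norm_num) fun x hx =>
      Real.rpow_nonneg (by linarith [hx.2]) _
  have ht0 : 0 ≤ (t - 1) ^ (-(1 / 4) : ℝ) := Real.rpow_nonneg (by linarith) _
  unfold legendreQ
  rw [abs_mul, abs_of_nonneg (by positivity), ← Real.norm_eq_abs (∫ x in (-1 : ℝ)..1, _)]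
  calc _ ≤ (1 / 2 : ℝ) ^ (l + 1) * (2 ^ l * (t - 1) ^ (-(1 / 4) : ℝ)
        * ∫ x in (-1 : ℝ)..1, (1 - x) ^ (-(3 / 4) : ℝ)) := by gcongr
    _ = (1 / 2) * ((∫ x in (-1 : ℝ)..1, (1 - x) ^ (-(3 / 4) : ℝ))
        * (t - 1) ^ (-(1 / 4) : ℝ)) := by
      rw [pow_succ, one_div, inv_pow]
      field_simp
    _ ≤ _ := by
      have := mul_nonneg hI ht0
      linarith

theorem energy_nonneg (c m p : ℝ) : 0 ≤ energy c m p := Real.sqrt_nonneg _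

theorem energy_zero_le (c m p : ℝ) : energy c m 0 ≤ energy c m p := by
  unfold energy
  refine Real.sqrt_le_sqrt ?_
  nlinarith [mul_nonneg (sq_nonneg c) (sq_nonneg p)]

theorem normFactor_nonneg (c m p : ℝ) : 0 ≤ normFactor c m p := Real.sqrt_nonneg _

theorem energy_add_div_le (c m p : ℝ) :
    |(energy c m p + energy c m 0) / normFactor c m p| ≤ 1 := by
  have h0 := energy_nonneg c m 0
  have h1 := energy_zero_le c m p
  rw [abs_of_nonneg (div_nonneg (by linarith) (normFactor_nonneg c m p))]
  refine div_le_one_of_le₀ (Real.le_sqrt_of_sq_le ?_) (Real.sqrt_nonneg _)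
  nlinarith

theorem mul_div_normFactor_le (c m p : ℝ) : |c * p / normFactor c m p| ≤ 1 := by
  have h0 := energy_nonneg c m 0
  have h1 := energy_zero_le c m p
  have h2 : energy c m p ^ 2 = c ^ 2 * p ^ 2 + m ^ 2 * c ^ 4 := Real.sq_sqrt (by positivity)
  have h3 : 0 ≤ m ^ 2 * c ^ 4 := by positivity
  rw [abs_div, abs_of_nonneg (normFactor_nonneg c m p)]
  refine div_le_one_of_le₀ (Real.abs_le_sqrt ?_) (Real.sqrt_nonneg _)
  nlinarith [mul_nonneg (h0.trans h1) h0]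

/-- The weight that dominates the kernel. -/
noncomputable def kernelWeight (r : ℝ) : ℝ := ((1 - r) ^ 2 / (2 * r)) ^ (-(1 / 4) : ℝ) / r

theorem kernelWeight_nonneg {r : ℝ} (hr : 0 < r) : 0 ≤ kernelWeight r :=
  div_nonneg (Real.rpow_nonneg (by positivity) _) hr.le

theorem measurable_kernelWeight : Measurable kernelWeight := by
  unfold kernelWeight
  fun_prop

theorem kernelWeight_eq {r : ℝ} (hr : 0 < r) :
    kernelWeight r = 2 ^ (1 / 4 : ℝ) * (|1 - r| ^ (-(1 / 2) : ℝ) * r ^ (-(3 / 4) : ℝ)) := by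
  unfold kernelWeight
  rw [← sq_abs (1 - r), Real.div_rpow (by positivity) (by positivity), ← Real.rpow_natCast,
    ← Real.rpow_mul (abs_nonneg _), Real.mul_rpow (by norm_num) hr.le,
    show ((2 : ℕ) : ℝ) * -(1 / 4) = -(1 / 2) by norm_num,
    show (-(3 / 4) : ℝ) = 1 / 4 - 1 by norm_num, Real.rpow_sub hr, Real.rpow_one,
    Real.rpow_neg (by norm_num) (1 / 4), Real.rpow_neg hr.le (1 / 4)]
  field_simp

theorem integrableOn_kernelWeight : IntegrableOn kernelWeight (Ioi 0) := by
  have h1 : IntegrableOn (fun r : ℝ => r ^ (-(3 / 4) : ℝ)) (Ioc 0 2) := by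
    have := intervalIntegral.intervalIntegrable_rpow' (a := 0) (b := 2)
      (show (-1 : ℝ) < -(3 / 4) by norm_num)
    rwa [intervalIntegrable_iff_integrableOn_Ioc_of_le (by norm_num)] at this
  have h0 : IntervalIntegrable (fun r : ℝ => |r| ^ (-(1 / 2) : ℝ)) volume 0 1 := by
    refine (intervalIntegral.intervalIntegrable_rpow' (a := 0) (b := 1)
      (show (-1 : ℝ) < -(1 / 2) by norm_num)).congr ?_
    intro r hr
    rw [uIoc_of_le (by norm_num)] at hr
    simp only [abs_of_pos hr.1]
  have h2 : IntegrableOn (fun r : ℝ => |1 - r| ^ (-(1 / 2) : ℝ)) (Ioc 0 2) := by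
    have ha := h0.comp_sub_left 1
    have hb := h0.comp_sub_right 1
    simp only [abs_sub_comm _ (1 : ℝ)] at hb
    norm_num at ha hb
    have := ha.symm.trans hb
    rwa [intervalIntegrable_iff_integrableOn_Ioc_of_le (by norm_num)] at this
  have h3 : IntegrableOn (fun r : ℝ => r ^ (-(5 / 4) : ℝ)) (Ioi 2) :=
    integrableOn_Ioi_rpow_of_lt (by norm_num) (by norm_num)
  rw [← Ioc_union_Ioi_eq_Ioi (show (0 : ℝ) ≤ 2 by norm_num)]
  refine IntegrableOn.union ?_ ?_
  · refine ((h1.add h2).const_mul (2 ^ (1 / 4 : ℝ) * 2)).mono'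
      measurable_kernelWeight.aestronglyMeasurable ?_
    refine (ae_restrict_iff' measurableSet_Ioc).2 (Filter.Eventually.of_forall fun r hr => ?_)
    rw [Real.norm_of_nonneg (kernelWeight_nonneg hr.1), kernelWeight_eq hr.1, mul_assoc]
    refine mul_le_mul_of_nonneg_left ?_ (by positivity)
    have hA : 0 ≤ |1 - r| ^ (-(1 / 2) : ℝ) := by positivity
    have hB : 0 ≤ r ^ (-(3 / 4) : ℝ) := Real.rpow_nonneg hr.1.le _
    have key : ∀ a : ℝ, 0 ≤ a → a ≤ 1 → (1 / 2 : ℝ) ^ (-a) ≤ 2 := by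
      intro a ha0 ha
      rw [one_div, Real.inv_rpow (by norm_num), Real.rpow_neg (by norm_num), inv_inv]
      calc (2 : ℝ) ^ a ≤ 2 ^ (1 : ℝ) := Real.rpow_le_rpow_of_exponent_le (by norm_num) ha
        _ = 2 := Real.rpow_one 2
    simp only [Pi.add_apply]
    rcases le_total (1 / 2) r with h | h
    · have : r ^ (-(3 / 4) : ℝ) ≤ 2 :=
        (Real.rpow_le_rpow_of_nonpos (by norm_num) h (by norm_num)).trans
          (key _ (by norm_num) (by norm_num))
      nlinarith
    · have : |1 - r| ^ (-(1 / 2) : ℝ) ≤ 2 :=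
        (Real.rpow_le_rpow_of_nonpos (by norm_num)
          (by rw [abs_of_nonneg (by linarith)]; linarith) (by norm_num)).trans
          (key _ (by norm_num) (by norm_num))
      nlinarith
  · refine (h3.const_mul (2 ^ (1 / 4 : ℝ) * 2 ^ (1 / 2 : ℝ))).mono'
      measurable_kernelWeight.aestronglyMeasurable ?_
    refine (ae_restrict_iff' measurableSet_Ioi).2 (Filter.Eventually.of_forall fun r hr => ?_)
    have hr2 : 2 < r := hr
    have hr0 : 0 < r := by linarith
    rw [Real.norm_of_nonneg (kernelWeight_nonneg hr0), kernelWeight_eq hr0, mul_assoc]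
    refine mul_le_mul_of_nonneg_left ?_ (by positivity)
    have : |1 - r| ^ (-(1 / 2) : ℝ) ≤ 2 ^ (1 / 2 : ℝ) * r ^ (-(1 / 2) : ℝ) := by
      calc |1 - r| ^ (-(1 / 2) : ℝ) ≤ (r / 2) ^ (-(1 / 2) : ℝ) :=
            Real.rpow_le_rpow_of_nonpos (by positivity)
              (by rw [abs_of_neg (by linarith)]; linarith) (by norm_num)
        _ = 2 ^ (1 / 2 : ℝ) * r ^ (-(1 / 2) : ℝ) := by
          rw [Real.div_rpow hr0.le (by norm_num), Real.rpow_neg (by norm_num : (0 : ℝ) ≤ 2),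
            div_inv_eq_mul, mul_comm]
    calc _ ≤ 2 ^ (1 / 2 : ℝ) * r ^ (-(1 / 2) : ℝ) * r ^ (-(3 / 4) : ℝ) :=
          mul_le_mul_of_nonneg_right this (Real.rpow_nonneg hr0.le _)
      _ = _ := by
        rw [mul_assoc, ← Real.rpow_add hr0]
        norm_num

theorem exists_kernel_bound (c m : ℝ) (l : ℕ) (s : Spin) : ∃ C : ℝ, 0 ≤ C ∧
    ∀ p' p : ℝ, 0 < p' → 0 < p → p' ≠ p →
      |kernel c m l s p' p| ≤ C * (kernelWeight (p / p') * (p / p')) := by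
  obtain ⟨C, hC, hQ⟩ := exists_legendreQ_bound
  refine ⟨2 * C, by positivity, fun p' p hp' hp hne => ?_⟩
  have ht : (p' / p + p / p') / 2 - 1 = (1 - p / p') ^ 2 / (2 * (p / p')) := by
    field_simp
    ring
  have ht1 : 1 < (p' / p + p / p') / 2 := by
    have : 0 < (1 - p / p') ^ 2 / (2 * (p / p')) := by
      have : 1 - p / p' ≠ 0 := by
        intro h
        rw [sub_eq_zero, eq_div_iff hp'.ne', one_mul] at h
        exact hne h
      positivity
    linarith
  have hw : ((p' / p + p / p') / 2 - 1) ^ (-(1 / 4) : ℝ) = kernelWeight (p / p') * (p / p') := by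
    rw [ht, kernelWeight, div_mul_cancel₀ _ (by positivity)]
  have q1 := hQ l _ ht1
  have q2 := hQ (s.shift l) _ ht1
  rw [hw] at q1 q2
  set W := kernelWeight (p / p') * (p / p')
  set T := (p' / p + p / p') / 2 with hT
  have e1 := energy_add_div_le c m p
  have e2 := energy_add_div_le c m p'
  have e3 := mul_div_normFactor_le c m p
  have e4 := mul_div_normFactor_le c m p'
  have hk : kernel c m l s p' p
      = legendreQ l T * (((energy c m p' + energy c m 0) / normFactor c m p')
          * ((energy c m p + energy c m 0) / normFactor c m p))
        + legendreQ (s.shift l) T * ((c * p' / normFactor c m p') * (c * p / normFactor c m p)) := by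
    simp only [kernel, ← hT]
    simp only [div_eq_mul_inv, mul_inv]
    ring
  have a1 : |((energy c m p' + energy c m 0) / normFactor c m p')
          * ((energy c m p + energy c m 0) / normFactor c m p)| ≤ 1 := by
    rw [abs_mul]
    exact mul_le_one₀ e2 (abs_nonneg _) e1
  have a2 : |(c * p' / normFactor c m p') * (c * p / normFactor c m p)| ≤ 1 := by
    rw [abs_mul]
    exact mul_le_one₀ e4 (abs_nonneg _) e3
  rw [hk]
  refine (abs_add_le _ _).trans ?_
  rw [abs_mul, abs_mul (legendreQ (s.shift l) T)]
  have b1 := mul_le_mul q1 a1 (abs_nonneg _) ((abs_nonneg _).trans q1)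
  have b2 := mul_le_mul q2 a2 (abs_nonneg _) ((abs_nonneg _).trans q2)
  linarith

theorem measurable_kernel (c m : ℝ) (l : ℕ) (s : Spin) :
    Measurable fun q : ℝ × ℝ => kernel c m l s q.1 q.2 := by
  have h1 := measurable_legendreQ l
  have h2 := measurable_legendreQ (s.shift l)
  unfold kernel normFactor energy
  fun_prop

/-- Schur-type bound: one half of the domination of the kernel term. -/
theorem integrable_kernelWeight_mul {v : RadialL2} (hv : v ∈ formDomain) :
    Integrable (fun q : ℝ × ℝ => ‖v q.1‖ ^ 2 * kernelWeight (q.2 / q.1))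
      (halfLine.prod halfLine) := by
  have hm : AEStronglyMeasurable (fun q : ℝ × ℝ => ‖v q.1‖ ^ 2 * kernelWeight (q.2 / q.1))
      (halfLine.prod halfLine) := by
    refine AEStronglyMeasurable.mul ((Lp.aestronglyMeasurable v).norm.pow 2).comp_fst ?_
    exact (measurable_kernelWeight.comp (measurable_snd.div measurable_fst)).aestronglyMeasurable
  rw [integrable_prod_iff hm]
  have hI : ∀ a : ℝ, 0 < a → IntegrableOn (fun p => kernelWeight (p / a)) (Ioi 0) := by
    intro a ha
    have := (integrableOn_Ioi_comp_mul_right_iff kernelWeight 0 (inv_pos.2 ha)).2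
      (by simpa using integrableOn_kernelWeight)
    simpa [div_eq_mul_inv] using this
  constructor
  · refine (ae_restrict_iff' measurableSet_Ioi).2 (Filter.Eventually.of_forall fun a ha => ?_)
    exact Integrable.const_mul (hI a ha) (‖v a‖ ^ 2)
  · have hv' : Integrable (fun p => √(1 + p ^ 2) * ‖v p‖ ^ 2) halfLine := hv
    refine (hv'.const_mul (∫ p in Ioi 0, kernelWeight p)).mono' ?_ ?_
    · exact hm.norm.integral_prod_right'
    · refine (ae_restrict_iff' measurableSet_Ioi).2 (Filter.Eventually.of_forall fun a ha => ?_)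
      have ha0 : (0 : ℝ) < a := ha
      have hnn : 0 ≤ ∫ p in Ioi 0, kernelWeight p :=
        setIntegral_nonneg measurableSet_Ioi fun p hp => kernelWeight_nonneg hp
      have : ∫ p in Ioi 0, ‖‖v a‖ ^ 2 * kernelWeight (p / a)‖
          = ‖v a‖ ^ 2 * (a * ∫ p in Ioi 0, kernelWeight p) := by
        have h1 : ∫ p in Ioi 0, kernelWeight (p / a) = a * ∫ p in Ioi 0, kernelWeight p := by
          have := integral_comp_mul_right_Ioi kernelWeight 0 (inv_pos.2 ha0)
          simpa [div_eq_mul_inv] using this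
        rw [← h1, ← integral_const_mul]
        refine setIntegral_congr_fun measurableSet_Ioi fun p hp => ?_
        exact Real.norm_of_nonneg (mul_nonneg (by positivity)
          (kernelWeight_nonneg (div_pos hp ha0)))
      rw [this, Real.norm_of_nonneg (by positivity)]
      have h2 : a ≤ √(1 + a ^ 2) := Real.le_sqrt_of_sq_le (by linarith)
      calc ‖v a‖ ^ 2 * (a * ∫ p in Ioi 0, kernelWeight p)
          = (∫ p in Ioi 0, kernelWeight p) * (a * ‖v a‖ ^ 2) := by ring
        _ ≤ _ := by gcongr

theorem integrable_kernel_term (c m : ℝ) (l : ℕ) (s : Spin) {v u : RadialL2}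
    (hv : v ∈ formDomain) (hu : u ∈ formDomain) :
    Integrable (fun q : ℝ × ℝ =>
      starRingEnd ℂ (v q.1) * (kernel c m l s q.1 q.2 : ℂ) * u q.2)
      (halfLine.prod halfLine) := by
  obtain ⟨C, hC, hk⟩ := exists_kernel_bound c m l s
  have hA := integrable_kernelWeight_mul hv
  have hB := (integrable_kernelWeight_mul hu).swap
  refine ((hA.add hB).const_mul C).mono' ?_ ?_
  · refine AEStronglyMeasurable.mul (AEStronglyMeasurable.mul ?_ ?_) ?_
    · exact (Complex.continuous_conj.comp_aestronglyMeasurable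
        (Lp.aestronglyMeasurable v)).comp_fst
    · exact (Complex.measurable_ofReal.comp (measurable_kernel c m l s)).aestronglyMeasurable
    · exact (Lp.aestronglyMeasurable u).comp_snd
  · have hne : ∀ᵐ q ∂(halfLine.prod halfLine), q.1 ≠ q.2 := by
      have hms : MeasurableSet {q : ℝ × ℝ | q.1 ≠ q.2} :=
        (measurableSet_eq_fun measurable_fst measurable_snd).compl
      rw [Measure.ae_prod_iff_ae_ae hms]
      refine Filter.Eventually.of_forall fun a => ?_
      have : ∀ᵐ b ∂halfLine, b ≠ a := compl_mem_ae_iff.2 (measure_singleton a)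
      filter_upwards [this] with b hb
      exact hb.symm
    have hpos : ∀ᵐ q ∂(halfLine.prod halfLine), q ∈ Ioi (0 : ℝ) ×ˢ Ioi (0 : ℝ) := by
      rw [Measure.prod_restrict]
      exact ae_restrict_mem (measurableSet_Ioi.prod measurableSet_Ioi)
    filter_upwards [hne, hpos] with q hq hp
    obtain ⟨h1, h2⟩ : 0 < q.1 ∧ 0 < q.2 := hp
    have hK := hk q.1 q.2 h1 h2 hq
    rw [norm_mul, norm_mul, RCLike.norm_conj, Complex.norm_real, Real.norm_eq_abs]
    simp only [Pi.add_apply, Function.comp_apply, Prod.fst_swap, Prod.snd_swap]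
    have hsymm : kernelWeight (q.1 / q.2)
        = kernelWeight (q.2 / q.1) * (q.2 / q.1) ^ 2 := by
      unfold kernelWeight
      rw [show (1 - q.1 / q.2) ^ 2 / (2 * (q.1 / q.2))
        = (1 - q.2 / q.1) ^ 2 / (2 * (q.2 / q.1)) by field_simp; ring]
      field_simp
    have hw := kernelWeight_nonneg (div_pos h2 h1)
    rw [hsymm]
    set W := kernelWeight (q.2 / q.1)
    set r := q.2 / q.1
    set a := ‖v q.1‖
    set b := ‖u q.2‖
    have ha : 0 ≤ a := norm_nonneg _
    have hb : 0 ≤ b := norm_nonneg _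
    have hr : 0 ≤ r := (div_pos h2 h1).le
    calc a * |kernel c m l s q.1 q.2| * b ≤ a * (C * (W * r)) * b := by gcongr
      _ = C * (W * (a * (b * r))) := by ring
      _ ≤ C * (W * (a ^ 2 + b ^ 2 * r ^ 2)) := by
        gcongr
        nlinarith [sq_nonneg (a - b * r), mul_nonneg ha (mul_nonneg hb hr)]
      _ = _ := by ring

theorem integrable_energy_term (c m : ℝ) {v u : RadialL2}
    (hv : v ∈ formDomain) (hu : u ∈ formDomain) :
    Integrable (fun p => (energy c m p : ℂ) * (starRingEnd ℂ (v p) * u p)) halfLine := by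
  have hv' : Integrable (fun p => √(1 + p ^ 2) * ‖v p‖ ^ 2) halfLine := hv
  have hu' : Integrable (fun p => √(1 + p ^ 2) * ‖u p‖ ^ 2) halfLine := hu
  have hem : Measurable (energy c m) := by
    unfold energy
    fun_prop
  refine ((hv'.add hu').const_mul √(c ^ 2 + m ^ 2 * c ^ 4)).mono' ?_ ?_
  · refine (Complex.measurable_ofReal.comp hem).aestronglyMeasurable.mul ?_
    exact (Complex.continuous_conj.comp_aestronglyMeasurable
      (Lp.aestronglyMeasurable v)).mul (Lp.aestronglyMeasurable u)
  · refine Filter.Eventually.of_forall fun p => ?_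
    rw [norm_mul, norm_mul, RCLike.norm_conj, Complex.norm_real,
      Real.norm_of_nonneg (energy_nonneg c m p)]
    have h1 : energy c m p ≤ √(c ^ 2 + m ^ 2 * c ^ 4) * √(1 + p ^ 2) := by
      rw [← Real.sqrt_mul (by positivity)]
      refine Real.sqrt_le_sqrt ?_
      have : 0 ≤ m ^ 2 * c ^ 4 * p ^ 2 + c ^ 2 := by positivity
      nlinarith
    have h2 : ‖v p‖ * ‖u p‖ ≤ ‖v p‖ ^ 2 + ‖u p‖ ^ 2 := by
      nlinarith [sq_nonneg (‖v p‖ - ‖u p‖), norm_nonneg (v p), norm_nonneg (u p)]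
    calc energy c m p * (‖v p‖ * ‖u p‖)
        ≤ (√(c ^ 2 + m ^ 2 * c ^ 4) * √(1 + p ^ 2)) * (‖v p‖ ^ 2 + ‖u p‖ ^ 2) := by gcongr
      _ = _ := by
        simp only [Pi.add_apply]
        ring

theorem form_add_right (c m α Z : ℝ) (l : ℕ) (s : Spin) {v u₁ u₂ : RadialL2}
    (hv : v ∈ formDomain) (h₁ : u₁ ∈ formDomain) (h₂ : u₂ ∈ formDomain) :
    form c m α Z l s v (u₁ + u₂ : RadialL2)
      = form c m α Z l s v u₁ + form c m α Z l s v u₂ := by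
  have hE : ∫ p, (energy c m p : ℂ) * (starRingEnd ℂ (v p) * (u₁ + u₂ : RadialL2) p) ∂halfLine
      = (∫ p, (energy c m p : ℂ) * (starRingEnd ℂ (v p) * u₁ p) ∂halfLine)
        + ∫ p, (energy c m p : ℂ) * (starRingEnd ℂ (v p) * u₂ p) ∂halfLine := by
    rw [← integral_add (integrable_energy_term c m hv h₁) (integrable_energy_term c m hv h₂)]
    refine integral_congr_ae ?_
    filter_upwards [Lp.coeFn_add u₁ u₂] with p hp
    rw [hp, Pi.add_apply]
    ring
  have hK : ∫ q : ℝ × ℝ, starRingEnd ℂ (v q.1) * (kernel c m l s q.1 q.2 : ℂ)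
        * (u₁ + u₂ : RadialL2) q.2 ∂(halfLine.prod halfLine)
      = (∫ q : ℝ × ℝ, starRingEnd ℂ (v q.1) * (kernel c m l s q.1 q.2 : ℂ) * u₁ q.2
          ∂(halfLine.prod halfLine))
        + ∫ q : ℝ × ℝ, starRingEnd ℂ (v q.1) * (kernel c m l s q.1 q.2 : ℂ) * u₂ q.2
          ∂(halfLine.prod halfLine) := by
    rw [← integral_add (integrable_kernel_term c m l s hv h₁)
      (integrable_kernel_term c m l s hv h₂)]
    refine integral_congr_ae ?_
    filter_upwards [Measure.quasiMeasurePreserving_snd.ae_eq (Lp.coeFn_add u₁ u₂)] with q hq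
    simp only [Function.comp_apply, Pi.add_apply] at hq
    rw [hq]
    ring
  unfold form
  rw [hE, hK]
  ring

theorem form_smul_right (c m α Z : ℝ) (l : ℕ) (s : Spin) (v u : RadialL2) (a : ℂ) :
    form c m α Z l s v (a • u : RadialL2) = a * form c m α Z l s v u := by
  have hE : ∫ p, (energy c m p : ℂ) * (starRingEnd ℂ (v p) * (a • u : RadialL2) p) ∂halfLine
      = a * ∫ p, (energy c m p : ℂ) * (starRingEnd ℂ (v p) * u p) ∂halfLine := by
    rw [← integral_const_mul]
    refine integral_congr_ae ?_
    filter_upwards [Lp.coeFn_smul a u] with p hp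
    rw [hp, Pi.smul_apply, smul_eq_mul]
    ring
  have hK : ∫ q : ℝ × ℝ, starRingEnd ℂ (v q.1) * (kernel c m l s q.1 q.2 : ℂ)
        * (a • u : RadialL2) q.2 ∂(halfLine.prod halfLine)
      = a * ∫ q : ℝ × ℝ, starRingEnd ℂ (v q.1) * (kernel c m l s q.1 q.2 : ℂ) * u q.2
          ∂(halfLine.prod halfLine) := by
    rw [← integral_const_mul]
    refine integral_congr_ae ?_
    filter_upwards [Measure.quasiMeasurePreserving_snd.ae_eq (Lp.coeFn_smul a u)] with q hq
    simp only [Function.comp_apply, Pi.smul_apply, smul_eq_mul] at hq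
    rw [hq]
    ring
  unfold form
  rw [hE, hK]
  ring

/-! ### The operators -/

/-- The graph of the operator associated with the form `β_{l,s}`: the pairs `(u, w)` with `u` in
the form domain and `β_{l,s}[v, u] = (v, w)` for every `v` in the form domain. -/
noncomputable def operatorGraph (c m α Z : ℝ) (l : ℕ) (s : Spin) :
    Submodule ℂ (RadialL2 × RadialL2) where
  carrier := {g | g.1 ∈ formDomain ∧ ∀ v ∈ formDomain, form c m α Z l s v g.1 = inner ℂ v g.2}
  zero_mem' := by
    refine ⟨formDomain.zero_mem, fun v _ => ?_⟩
    have := form_smul_right c m α Z l s v 0 0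
    simpa using this
  add_mem' := by
    rintro ⟨u₁, w₁⟩ ⟨u₂, w₂⟩ ⟨h₁, k₁⟩ ⟨h₂, k₂⟩
    refine ⟨formDomain.add_mem h₁ h₂, fun v hv => ?_⟩
    have e₁ := k₁ v hv
    have e₂ := k₂ v hv
    simp only at e₁ e₂
    simp only [Prod.mk_add_mk, inner_add_right]
    rw [form_add_right c m α Z l s hv h₁ h₂, e₁, e₂]
  smul_mem' := by
    rintro a ⟨u, w⟩ ⟨h, k⟩
    refine ⟨formDomain.smul_mem a h, fun v hv => ?_⟩
    have e := k v hv
    simp only at e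
    simp only [Prod.smul_mk, inner_smul_right]
    rw [form_smul_right, e]

theorem operatorGraph_functional (c m α Z : ℝ) (l : ℕ) (s : Spin) (g : RadialL2 × RadialL2)
    (hg : g ∈ operatorGraph c m α Z l s) (h0 : g.1 = 0) : g.2 = 0 := by
  refine eq_zero_of_forall_inner_eq_zero _ fun v hv => ?_
  rw [← hg.2 v hv, h0]
  have := form_smul_right c m α Z l s v 0 0
  simpa using this

/-- The operator `b_{l,s}` in `L²(0, ∞)` associated with the form `β_{l,s}`: `u ∈ D(b_{l,s})` and
`b_{l,s} u = w` mean that `u` is in the form domain and `β_{l,s}[v, u] = (v, w)` for every `v` in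
the form domain. The form domain is that of the closed form, so that this is the Friedrichs
extension wherever the operator on a smaller domain has several self-adjoint extensions. -/
noncomputable def partialWaveOperator (c m α Z : ℝ) (l : ℕ) (s : Spin) : RadialL2 →ₗ.[ℂ] RadialL2 :=
  (operatorGraph c m α Z l s).toLinearPMap

theorem graph_partialWaveOperator (c m α Z : ℝ) (l : ℕ) (s : Spin) :
    (partialWaveOperator c m α Z l s).graph = operatorGraph c m α Z l s :=
  Submodule.toLinearPMap_graph_eq _ (operatorGraph_functional c m α Z l s)

/-- `ev` is an eigenvalue of the (unbounded) operator `T`. -/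
def IsEigenvalue (T : RadialL2 →ₗ.[ℂ] RadialL2) (ev : ℂ) : Prop :=
  ∃ u : T.domain, u ≠ 0 ∧ T u = ev • (u : RadialL2)

/-- The critical charge `Z_c = 2 / [(π/2 + 2/π) α]`. -/
noncomputable def criticalCharge (α : ℝ) : ℝ := 2 / ((Real.pi / 2 + 2 / Real.pi) * α)

end BrownRavenhall

namespace BrownRavenhall

open MeasureTheory Set Filter Topology ComplexConjugate

/-! The proof is a virial argument followed by a Schur test. Write `e₀ = e(0) = mc²`, `x = e₀/e(p)`,
`y = cp/e(p)`, `γ = αcZ/π`, and let `j = l + 2s`.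

Let `u` be an eigenfunction with eigenvalue `νe₀`, `ν ≥ 1`. Testing the weak equation with the
dilates `u(θ·)` and `u(θ⁻¹·)` and subtracting removes the eigenvalue; dividing by `θ - 1` and
letting `θ → 1` gives the virial identity (`WeakEigen.virial`). The Legendre functions depend only
on `p'/p`, so the dilation derivative of the kernel falls on the spinor coefficients alone, whose
logarithmic derivatives are polynomials in `x`. That derivative equals `k(p',p) (w(p') + w(p))/2`
with `w = 1 - x + x²`, plus a remainder containing only `Q_j` and the lower coefficients. The
equation tested with `wu` eliminates the first part and leaves (`WeakEigen.reduced_virial`) `e₀ ∫ (1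
- 2x + νw)|u|² = γ ∬ ū (x' + x) Q_j L' L u`, where `L² = (1 - x)/2`.

A Schur test with power weights (`WeightedL2.norm_lowerKernel_pairing_le`) bounds the right side by
`e₀ ∫ a(1 - x)(1 + y)|u|²`, where `a = γM_j/(2c)` and `M_j = ∫ Q_j r^(-1/2) dr` in the ratio
variable. On the circle `x² + y² = 1` the elementary inequality `schur_gap_pos` makes the left
density strictly larger, except at one momentum, if `a ≤ 3/4` or `2a - 1/2 ≤ ν`. Hence `u = 0`
almost everywhere.

It remains to know `M_j`. An explicit primitive gives `M_0 = 2π`, so `a = αZ` when `j = 0`, which is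
the exceptional pair `(1, -1/2)`. For `j ≥ 1` the decay `Q_j ≤ ρ^j Q_0` gives `M_j ≤ 2π - 4 log 2`,
and then `a ≤ 3/4` for every subcritical `Z`. -/

/-- The argument `(r + r⁻¹) / 2` of the Legendre functions, as a function of the ratio of momenta. -/
noncomputable def joukowsky (r : ℝ) : ℝ := (r + r⁻¹) / 2

theorem joukowsky_inv (r : ℝ) : joukowsky r⁻¹ = joukowsky r := by
  unfold joukowsky
  rw [inv_inv, add_comm]

theorem joukowsky_sub_one {r : ℝ} (hr : 0 < r) : joukowsky r - 1 = (1 - r) ^ 2 / (2 * r) := by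
  unfold joukowsky
  field_simp
  ring

theorem joukowsky_add_one {r : ℝ} (hr : 0 < r) : joukowsky r + 1 = (1 + r) ^ 2 / (2 * r) := by
  unfold joukowsky
  field_simp
  ring

theorem one_lt_joukowsky {r : ℝ} (hr : 0 < r) (h1 : r ≠ 1) : 1 < joukowsky r := by
  have h : 0 < (1 - r) ^ 2 / (2 * r) := by
    have : 1 - r ≠ 0 := sub_ne_zero.2 h1.symm
    positivity
  linarith [joukowsky_sub_one hr]

/-! ### Legendre functions: closed form of `Q₀` and decay in `l`. -/

theorem legendreQ_zero {t : ℝ} (ht : 1 < t) :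
    legendreQ 0 t = (Real.log (t + 1) - Real.log (t - 1)) / 2 := by
  have h : ∫ x in (-1 : ℝ)..1, (1 - x ^ 2) ^ 0 / (t - x) ^ (0 + 1)
      = Real.log (t + 1) - Real.log (t - 1) := by
    have := intervalIntegral.integral_comp_sub_left (fun x : ℝ => x⁻¹) (a := -1) (b := 1) t
    rw [integral_inv_of_pos (by linarith) (by linarith),
      Real.log_div (by linarith) (by linarith)] at this
    simpa using this
  rw [legendreQ, h]
  ring

/-- Both `t + 1` and `t - 1` are squares divided by `2r`, which cancels the factor `1/2` of `Q₀`.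
Since `Real.log` is `log |·|`, the formula is valid on both sides of `r = 1`. -/
theorem legendreQ_zero_joukowsky {r : ℝ} (hr : 0 < r) (h1 : r ≠ 1) :
    legendreQ 0 (joukowsky r) = Real.log (1 + r) - Real.log (1 - r) := by
  have h2 : 1 - r ≠ 0 := sub_ne_zero.2 h1.symm
  rw [legendreQ_zero (one_lt_joukowsky hr h1), joukowsky_sub_one hr, joukowsky_add_one hr,
    Real.log_div (by positivity) (by positivity), Real.log_div (by positivity) (by positivity),
    Real.log_pow, Real.log_pow]
  push_cast
  ring

theorem legendreQ_nonneg (l : ℕ) {t : ℝ} (ht : 1 < t) : 0 ≤ legendreQ l t := by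
  refine mul_nonneg (by positivity) (intervalIntegral.integral_nonneg (by norm_num) fun x hx => ?_)
  have h1 : 0 ≤ 1 - x ^ 2 := by nlinarith [hx.1, hx.2]
  have h2 : 0 < t - x := by linarith [hx.2]
  positivity

/-- The decay of `Q_l` in `l`, by comparison of the integrands. -/
theorem legendreQ_le_pow_mul (l : ℕ) {ρ : ℝ} (h0 : 0 < ρ) (h1 : ρ < 1) :
    legendreQ l (joukowsky ρ) ≤ ρ ^ l * legendreQ 0 (joukowsky ρ) := by
  have ht := one_lt_joukowsky h0 h1.ne
  set t := joukowsky ρ with htd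
  have hcont : ∀ k : ℕ, IntervalIntegrable
      (fun x : ℝ => (1 - x ^ 2) ^ k / (t - x) ^ (k + 1)) volume (-1) 1 := by
    intro k
    refine ContinuousOn.intervalIntegrable ?_
    rw [uIcc_of_le (by norm_num)]
    refine ContinuousOn.div (by fun_prop) (by fun_prop) fun x hx => ?_
    have : 0 < t - x := by linarith [hx.2]
    positivity
  have hint : ∫ x in (-1 : ℝ)..1, (1 - x ^ 2) ^ l / (t - x) ^ (l + 1)
      ≤ ∫ x in (-1 : ℝ)..1, (2 * ρ) ^ l * ((1 - x ^ 2) ^ 0 / (t - x) ^ (0 + 1)) := by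
    refine intervalIntegral.integral_mono_on (by norm_num) (hcont l) ((hcont 0).const_mul _)
      fun x hx => ?_
    have hx2 : 0 ≤ 1 - x ^ 2 := by nlinarith [hx.1, hx.2]
    have htx : 0 < t - x := by linarith [hx.2]
    have hρt : 2 * ρ * t = ρ ^ 2 + 1 := by
      rw [htd, joukowsky]
      field_simp
    -- Because `2ρt = ρ² + 1`, this is `(ρ - x)² ≥ 0`. Its `l`-th power trades each factor of the
    -- integrand of `Q_l` for `2ρ`, and the `2^l` is absorbed by the normalisation.
    have hle : 1 - x ^ 2 ≤ 2 * ρ * (t - x) := by nlinarith [sq_nonneg (ρ - x)]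
    have hp := pow_le_pow_left₀ hx2 hle l
    rw [mul_pow] at hp
    rw [pow_zero, zero_add, pow_one, mul_one_div, div_le_div_iff₀ (by positivity) htx]
    calc (1 - x ^ 2) ^ l * (t - x) ≤ ((2 * ρ) ^ l * (t - x) ^ l) * (t - x) := by gcongr
      _ = _ := by ring
  rw [intervalIntegral.integral_const_mul] at hint
  unfold legendreQ
  calc _ ≤ (1 / 2 : ℝ) ^ (l + 1) * ((2 * ρ) ^ l
        * ∫ x in (-1 : ℝ)..1, (1 - x ^ 2) ^ 0 / (t - x) ^ (0 + 1)) := by gcongr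
    _ = ((1 / 2 : ℝ) ^ l * 2 ^ l) * (ρ ^ l * ((1 / 2) ^ (0 + 1)
        * ∫ x in (-1 : ℝ)..1, (1 - x ^ 2) ^ 0 / (t - x) ^ (0 + 1))) := by
      rw [mul_pow]
      ring
    _ = _ := by
      rw [← mul_pow]
      norm_num

/-! ### The Mellin integral of `Q₀` -/

/-- A primitive of `Q₀((r + r⁻¹) / 2) r^{-1/2}`. -/
noncomputable def legendrePrimitive (r : ℝ) : ℝ :=
  2 * (√r * Real.log (1 + r) - (1 + √r) * Real.log (1 + √r) + (1 - √r) * Real.log (1 - √r)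
    + 2 * Real.arctan √r)

theorem legendrePrimitive_zero : legendrePrimitive 0 = 0 := by
  simp [legendrePrimitive]

theorem legendrePrimitive_one : legendrePrimitive 1 = Real.pi - 2 * Real.log 2 := by
  simp only [legendrePrimitive, Real.sqrt_one, Real.arctan_one]
  norm_num
  ring

theorem continuousOn_legendrePrimitive : ContinuousOn legendrePrimitive (Ici 0) := by
  have h1 : ContinuousOn (fun r : ℝ => Real.log (1 + r)) (Ici 0) :=
    ContinuousOn.log (by fun_prop) fun r hr => by
      have : (0 : ℝ) ≤ r := hr
      positivity
  have h2 : Continuous fun r : ℝ => (1 - √r) * Real.log (1 - √r) :=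
    Real.continuous_mul_log.comp (by fun_prop : Continuous fun r : ℝ => 1 - √r)
  have h3 : Continuous fun r : ℝ => (1 + √r) * Real.log (1 + √r) :=
    Real.continuous_mul_log.comp (by fun_prop : Continuous fun r : ℝ => 1 + √r)
  have h4 : Continuous fun r : ℝ => Real.arctan √r := Real.continuous_arctan.comp Real.continuous_sqrt
  unfold legendrePrimitive
  exact continuousOn_const.mul ((((Real.continuous_sqrt.continuousOn.mul h1).sub h3.continuousOn).add
    h2.continuousOn).add (h4.const_mul 2).continuousOn)

theorem hasDerivAt_legendrePrimitive {r : ℝ} (hr : 0 < r) (h1 : r ≠ 1) :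
    HasDerivAt legendrePrimitive (legendreQ 0 (joukowsky r) * r ^ (-(1 / 2) : ℝ)) r := by
  have hs : 0 < √r := Real.sqrt_pos.2 hr
  have hs1 : 1 - √r ≠ 0 := by
    intro h
    have : √r = 1 := by linarith
    exact h1 (by rw [← Real.sq_sqrt hr.le, this, one_pow])
  have d0 := Real.hasDerivAt_sqrt hr.ne'
  have d1 : HasDerivAt (fun r : ℝ => Real.log (1 + r)) (1 / (1 + r)) r :=
    ((hasDerivAt_id r).const_add 1).log (by simp; positivity)
  have d2 : HasDerivAt (fun r : ℝ => Real.log (1 + √r)) (1 / (2 * √r) / (1 + √r)) r :=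
    (d0.const_add 1).log (by positivity)
  have d3 : HasDerivAt (fun r : ℝ => Real.log (1 - √r)) (-(1 / (2 * √r)) / (1 - √r)) r :=
    (d0.const_sub 1).log hs1
  have d4 := d0.arctan
  have d := ((((d0.mul d1).sub ((d0.const_add 1).mul d2)).add ((d0.const_sub 1).mul d3)).add
    (d4.const_mul 2)).const_mul 2
  refine d.congr_deriv ?_
  rw [legendreQ_zero_joukowsky hr h1, Real.rpow_neg hr.le, ← Real.sqrt_eq_rpow]
  -- The factorisation `1 - r = (1 + √r)(1 - √r)` turns the identity into a rational one in `s =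
  -- √r`. For `r > 1` the logarithms are of absolute values, so only nonvanishing of the factors is
  -- needed.
  have hl : Real.log (1 - r) = Real.log (1 + √r) + Real.log (1 - √r) := by
    rw [← Real.log_mul (by positivity) hs1]
    congr 1
    nlinarith [Real.sq_sqrt hr.le]
  rw [hl]
  have hr2 : r = √r ^ 2 := (Real.sq_sqrt hr.le).symm
  set s := √r
  have hs2 : 1 + s ^ 2 ≠ 0 := by positivity
  rw [hr2]
  field_simp
  ring

/-- In `s = √r` the logarithms regroup for `s > 1` into `s log((1 + s²)/(s² - 1)) - log((s + 1)/(s -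
1))`. Both terms vanish at infinity, and only the arctangent contributes. -/
theorem tendsto_legendrePrimitive : Tendsto legendrePrimitive atTop (𝓝 (2 * Real.pi)) := by
  have hF : Tendsto (fun s : ℝ => s * Real.log ((1 + s ^ 2) / (s ^ 2 - 1))
      - Real.log ((s + 1) / (s - 1)) + 2 * Real.arctan s) atTop (𝓝 (0 - 0 + 2 * (Real.pi / 2))) := by
    refine (Tendsto.sub ?_ ?_).add
      ((Real.tendsto_arctan_atTop.mono_right nhdsWithin_le_nhds).const_mul 2)
    · have hb : Tendsto (fun s : ℝ => 4 * s⁻¹) atTop (𝓝 0) := by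
        simpa using tendsto_inv_atTop_zero.const_mul (4 : ℝ)
      refine tendsto_of_tendsto_of_tendsto_of_le_of_le' tendsto_const_nhds hb ?_ ?_
      · filter_upwards [eventually_gt_atTop 2] with s hs
        have : 0 < s ^ 2 - 1 := by nlinarith
        refine mul_nonneg (by linarith) (Real.log_nonneg ?_)
        rw [le_div_iff₀ this]
        linarith
      · filter_upwards [eventually_gt_atTop 2] with s hs
        have h1 : 0 < s ^ 2 - 1 := by nlinarith
        have h2 := Real.log_le_sub_one_of_pos (show 0 < (1 + s ^ 2) / (s ^ 2 - 1) by positivity)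
        have h3 : (1 + s ^ 2) / (s ^ 2 - 1) - 1 = 2 / (s ^ 2 - 1) := by
          field_simp
          ring
        rw [h3] at h2
        calc _ ≤ s * (2 / (s ^ 2 - 1)) := by gcongr
          _ ≤ 4 * s⁻¹ := by
            rw [mul_div_assoc', ← div_eq_mul_inv, div_le_div_iff₀ h1 (by linarith)]
            nlinarith
    · have h1 : Tendsto (fun s : ℝ => (s + 1) / (s - 1)) atTop (𝓝 1) := by
        have h2 : Tendsto (fun s : ℝ => 1 + 2 * (s - 1)⁻¹) atTop (𝓝 (1 + 2 * 0)) :=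
          ((tendsto_inv_atTop_zero.comp
            (tendsto_atTop_add_const_right atTop (-1 : ℝ) tendsto_id)).const_mul 2).const_add 1
        rw [mul_zero, add_zero] at h2
        refine h2.congr' ?_
        filter_upwards [eventually_gt_atTop 2] with s hs
        have : s - 1 ≠ 0 := by linarith
        field_simp
        ring
      have := h1.log one_ne_zero
      rwa [Real.log_one] at this
  have hF2 := (hF.comp Real.tendsto_sqrt_atTop).const_mul 2
  rw [show 2 * (0 - 0 + 2 * (Real.pi / 2)) = 2 * Real.pi by ring] at hF2
  refine hF2.congr' ?_
  filter_upwards [eventually_gt_atTop 2] with r hr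
  have hs : 1 < √r := Real.lt_sqrt_of_sq_lt (by linarith)
  have hr2 : r = √r ^ 2 := (Real.sq_sqrt (by linarith)).symm
  simp only [Function.comp_apply, legendrePrimitive]
  have e1 : Real.log (1 - √r) = Real.log (√r - 1) := by
    rw [← Real.log_neg_eq_log, neg_sub]
  have e2 : Real.log (√r ^ 2 - 1) = Real.log (√r - 1) + Real.log (√r + 1) := by
    rw [← Real.log_mul (by linarith) (by linarith)]
    ring_nf
  rw [e1, Real.log_div (by positivity) (by nlinarith), Real.log_div (by positivity) (by linarith),
    e2, add_comm (√r) 1, ← hr2]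
  ring

theorem rpow_neg_nonneg_of_mem {r a : ℝ} (hr : 0 < r) (h1 : r ≠ 1) :
    0 ≤ legendreQ 0 (joukowsky r) * r ^ a :=
  mul_nonneg (legendreQ_nonneg 0 (one_lt_joukowsky hr h1)) (Real.rpow_nonneg hr.le _)

/-- The integrand has a logarithmic singularity at `r = 1`, but it is nonnegative and has a
primitive continuous up to the endpoints, so integrability needs no separate estimate. -/
theorem legendreQ_zero_Ioc :
    IntegrableOn (fun r => legendreQ 0 (joukowsky r) * r ^ (-(1 / 2) : ℝ)) (Ioc 0 1) ∧
    ∫ r in Ioc 0 1, legendreQ 0 (joukowsky r) * r ^ (-(1 / 2) : ℝ)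
      = Real.pi - 2 * Real.log 2 := by
  have hc : ContinuousOn legendrePrimitive (Icc 0 1) :=
    continuousOn_legendrePrimitive.mono fun r hr => hr.1
  have hd : ∀ r ∈ Ioo (0 : ℝ) 1, HasDerivAt legendrePrimitive
      (legendreQ 0 (joukowsky r) * r ^ (-(1 / 2) : ℝ)) r := fun r hr =>
    hasDerivAt_legendrePrimitive hr.1 hr.2.ne
  have hi := intervalIntegral.integrableOn_deriv_of_nonneg hc hd fun r hr =>
    rpow_neg_nonneg_of_mem hr.1 hr.2.ne
  refine ⟨hi, ?_⟩
  rw [← intervalIntegral.integral_of_le zero_le_one,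
    intervalIntegral.integral_eq_sub_of_hasDerivAt_of_le zero_le_one hc hd
      ((intervalIntegrable_iff_integrableOn_Ioc_of_le zero_le_one).2 hi),
    legendrePrimitive_one, legendrePrimitive_zero, sub_zero]

theorem legendreQ_zero_Ioi_one :
    IntegrableOn (fun r => legendreQ 0 (joukowsky r) * r ^ (-(1 / 2) : ℝ)) (Ioi 1) ∧
    ∫ r in Ioi 1, legendreQ 0 (joukowsky r) * r ^ (-(1 / 2) : ℝ)
      = 2 * Real.pi - (Real.pi - 2 * Real.log 2) := by
  have hc : ContinuousWithinAt legendrePrimitive (Ici 1) 1 :=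
    (continuousOn_legendrePrimitive 1 (by simp)).mono (Ici_subset_Ici.2 zero_le_one)
  have hd : ∀ r ∈ Ioi (1 : ℝ), HasDerivAt legendrePrimitive
      (legendreQ 0 (joukowsky r) * r ^ (-(1 / 2) : ℝ)) r := fun r hr =>
    hasDerivAt_legendrePrimitive (zero_lt_one.trans hr) (ne_of_gt hr)
  have hn : ∀ r ∈ Ioi (1 : ℝ), 0 ≤ legendreQ 0 (joukowsky r) * r ^ (-(1 / 2) : ℝ) := fun r hr =>
    rpow_neg_nonneg_of_mem (zero_lt_one.trans hr) (ne_of_gt hr)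
  refine ⟨integrableOn_Ioi_deriv_of_nonneg hc hd hn tendsto_legendrePrimitive, ?_⟩
  rw [integral_Ioi_of_hasDerivAt_of_nonneg hc hd hn tendsto_legendrePrimitive,
    legendrePrimitive_one]

/-- The inversion `r ↦ r⁻¹` fixes the argument of `Q₀` and carries this integral to the one over
`(0, 1]` with exponent `-1/2`; accordingly `-F(r⁻¹)` is a primitive, with `F` that of the first
integral. -/
theorem legendreQ_zero_Ioi_one' :
    IntegrableOn (fun r => legendreQ 0 (joukowsky r) * r ^ (-(3 / 2) : ℝ)) (Ioi 1) ∧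
    ∫ r in Ioi 1, legendreQ 0 (joukowsky r) * r ^ (-(3 / 2) : ℝ)
      = Real.pi - 2 * Real.log 2 := by
  have hci : ContinuousOn (fun r : ℝ => -legendrePrimitive r⁻¹) (Ici 1) := by
    refine (continuousOn_legendrePrimitive.comp
      (continuousOn_inv₀.mono fun r hr => ?_) fun r hr => ?_).neg
    · exact (zero_lt_one.trans_le hr).ne'
    · exact inv_nonneg.2 (zero_le_one.trans (show (1 : ℝ) ≤ r from hr))
  have hc := hci 1 self_mem_Ici
  have hd : ∀ r ∈ Ioi (1 : ℝ), HasDerivAt (fun r : ℝ => -legendrePrimitive r⁻¹)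
      (legendreQ 0 (joukowsky r) * r ^ (-(3 / 2) : ℝ)) r := by
    intro r hr
    have h0 : 0 < r := zero_lt_one.trans hr
    have h1 : r⁻¹ ≠ 1 := (inv_lt_one_of_one_lt₀ hr).ne
    have := ((hasDerivAt_legendrePrimitive (inv_pos.2 h0) h1).comp r (hasDerivAt_inv h0.ne')).neg
    refine this.congr_deriv ?_
    rw [joukowsky_inv, Real.inv_rpow h0.le, ← Real.rpow_neg h0.le,
      show (-(3 / 2) : ℝ) = - -(1 / 2) + (-2 : ℤ) by norm_num, Real.rpow_add h0,
      Real.rpow_intCast, zpow_neg, zpow_ofNat]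
    ring
  have hn : ∀ r ∈ Ioi (1 : ℝ), 0 ≤ legendreQ 0 (joukowsky r) * r ^ (-(3 / 2) : ℝ) := fun r hr =>
    rpow_neg_nonneg_of_mem (zero_lt_one.trans hr) (ne_of_gt hr)
  have ht : Tendsto (fun r : ℝ => -legendrePrimitive r⁻¹) atTop (𝓝 0) := by
    have h1 : Tendsto legendrePrimitive (𝓝[Ici 0] 0) (𝓝 0) := by
      have := continuousOn_legendrePrimitive 0 self_mem_Ici
      rwa [ContinuousWithinAt, legendrePrimitive_zero] at this
    have h2 : Tendsto (fun r : ℝ => r⁻¹) atTop (𝓝[Ici 0] 0) :=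
      tendsto_inv_atTop_nhdsGT_zero.mono_right (nhdsWithin_mono _ Ioi_subset_Ici_self)
    simpa using (h1.comp h2).neg
  refine ⟨integrableOn_Ioi_deriv_of_nonneg hc hd hn ht, ?_⟩
  rw [integral_Ioi_of_hasDerivAt_of_nonneg hc hd hn ht]
  simp [legendrePrimitive_one]

/-- The Mellin integral of `Q_l`, the constant in the Schur test. -/
noncomputable def legendreMellin (l : ℕ) : ℝ :=
  ∫ r in Ioi 0, legendreQ l (joukowsky r) * r ^ (-(1 / 2) : ℝ)

theorem measurable_legendreQ_joukowsky (l : ℕ) : Measurable fun r => legendreQ l (joukowsky r) :=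
  (measurable_legendreQ l).comp (by unfold joukowsky; fun_prop)

theorem legendreQ_le_zero (l : ℕ) {r : ℝ} (h0 : 0 < r) (h1 : r ≠ 1) :
    legendreQ l (joukowsky r) ≤ legendreQ 0 (joukowsky r) := by
  have key : ∀ ρ : ℝ, 0 < ρ → ρ < 1 →
      legendreQ l (joukowsky ρ) ≤ legendreQ 0 (joukowsky ρ) := fun ρ h0 h1 =>
    (legendreQ_le_pow_mul l h0 h1).trans (mul_le_of_le_one_left
      (legendreQ_nonneg 0 (one_lt_joukowsky h0 h1.ne)) (pow_le_one₀ h0.le h1.le))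
  rcases lt_or_gt_of_ne h1 with h | h
  · exact key r h0 h
  · have := key r⁻¹ (inv_pos.2 h0) (inv_lt_one_of_one_lt₀ h)
    rwa [joukowsky_inv] at this

theorem integrableOn_legendreQ_zero_rpow :
    IntegrableOn (fun r => legendreQ 0 (joukowsky r) * r ^ (-(1 / 2) : ℝ)) (Ioi 0) := by
  rw [← Ioc_union_Ioi_eq_Ioi (zero_le_one (α := ℝ))]
  exact legendreQ_zero_Ioc.1.union legendreQ_zero_Ioi_one.1

theorem ae_ne_one (s : Set ℝ) : ∀ᵐ r ∂(volume.restrict s), r ≠ 1 :=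
  ae_restrict_of_ae (compl_mem_ae_iff.2 (measure_singleton 1))

theorem integrableOn_legendreQ_rpow (l : ℕ) :
    IntegrableOn (fun r => legendreQ l (joukowsky r) * r ^ (-(1 / 2) : ℝ)) (Ioi 0) := by
  refine integrableOn_legendreQ_zero_rpow.mono'
    ((measurable_legendreQ_joukowsky l).mul (by fun_prop)).aestronglyMeasurable ?_
  filter_upwards [ae_restrict_mem measurableSet_Ioi, ae_ne_one _] with r hr h1
  have hr0 : (0 : ℝ) < r := hr
  have hq := legendreQ_nonneg l (one_lt_joukowsky hr0 h1)
  rw [Real.norm_of_nonneg (mul_nonneg hq (Real.rpow_nonneg hr0.le _))]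
  exact mul_le_mul_of_nonneg_right (legendreQ_le_zero l hr0 h1) (Real.rpow_nonneg hr0.le _)

theorem legendreMellin_zero : legendreMellin 0 = 2 * Real.pi := by
  unfold legendreMellin
  rw [← Ioc_union_Ioi_eq_Ioi (zero_le_one (α := ℝ)),
    setIntegral_union (Ioc_disjoint_Ioi le_rfl) measurableSet_Ioi legendreQ_zero_Ioc.1
      legendreQ_zero_Ioi_one.1, legendreQ_zero_Ioc.2, legendreQ_zero_Ioi_one.2]
  ring

/-- On `(0, 1]` the bound `Q_l ≤ Q_0` suffices. On `(1, ∞)` one power of the decay, `Q_l ≤ r⁻¹ Q_0`,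
lowers the exponent to `-3/2`, and inversion makes that integral equal to the first one. -/
theorem legendreMellin_le {l : ℕ} (hl : l ≠ 0) :
    legendreMellin l ≤ 2 * Real.pi - 4 * Real.log 2 := by
  have hI := integrableOn_legendreQ_rpow l
  have hA := hI.mono_set (Ioc_subset_Ioi_self : Ioc (0 : ℝ) 1 ⊆ Ioi 0)
  have hB := hI.mono_set (Ioi_subset_Ioi (zero_le_one (α := ℝ)))
  unfold legendreMellin
  rw [← Ioc_union_Ioi_eq_Ioi (zero_le_one (α := ℝ)),
    setIntegral_union (Ioc_disjoint_Ioi le_rfl) measurableSet_Ioi hA hB]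
  have h1 : ∫ r in Ioc 0 1, legendreQ l (joukowsky r) * r ^ (-(1 / 2) : ℝ)
      ≤ Real.pi - 2 * Real.log 2 := by
    rw [← legendreQ_zero_Ioc.2]
    refine integral_mono_ae hA legendreQ_zero_Ioc.1 ?_
    filter_upwards [ae_restrict_mem measurableSet_Ioc, ae_ne_one _] with r hr h1
    exact mul_le_mul_of_nonneg_right (legendreQ_le_zero l hr.1 h1) (Real.rpow_nonneg hr.1.le _)
  have h2 : ∫ r in Ioi 1, legendreQ l (joukowsky r) * r ^ (-(1 / 2) : ℝ)
      ≤ Real.pi - 2 * Real.log 2 := by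
    rw [← legendreQ_zero_Ioi_one'.2]
    refine integral_mono_ae hB legendreQ_zero_Ioi_one'.1 ?_
    filter_upwards [ae_restrict_mem measurableSet_Ioi] with r hr
    have h0 : 0 < r := zero_lt_one.trans hr
    have hlt : r⁻¹ < 1 := inv_lt_one_of_one_lt₀ hr
    have h := legendreQ_le_pow_mul l (inv_pos.2 h0) hlt
    rw [joukowsky_inv] at h
    have hq := legendreQ_nonneg 0 (one_lt_joukowsky h0 (ne_of_gt hr))
    have h' : legendreQ l (joukowsky r) ≤ r⁻¹ * legendreQ 0 (joukowsky r) :=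
      h.trans (mul_le_mul_of_nonneg_right
        (pow_le_of_le_one (inv_pos.2 h0).le hlt.le hl) hq)
    calc _ ≤ (r⁻¹ * legendreQ 0 (joukowsky r)) * r ^ (-(1 / 2) : ℝ) :=
          mul_le_mul_of_nonneg_right h' (Real.rpow_nonneg h0.le _)
      _ = _ := by
        rw [show (-(3 / 2) : ℝ) = -1 + -(1 / 2) by norm_num, Real.rpow_add h0, Real.rpow_neg_one]
        ring
  linarith

/-- The inversion `r ↦ r⁻¹` exchanges the two exponents. -/
theorem legendreQ_rpow_inv (l : ℕ) :
    IntegrableOn (fun r => legendreQ l (joukowsky r) * r ^ (-(3 / 2) : ℝ)) (Ioi 0) ∧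
    ∫ r in Ioi 0, legendreQ l (joukowsky r) * r ^ (-(3 / 2) : ℝ) = legendreMellin l := by
  have he : ∀ r ∈ Ioi (0 : ℝ), (|(-1 : ℝ)| * r ^ ((-1 : ℝ) - 1))
      • (legendreQ l (joukowsky (r ^ (-1 : ℝ))) * (r ^ (-1 : ℝ)) ^ (-(1 / 2) : ℝ))
      = legendreQ l (joukowsky r) * r ^ (-(3 / 2) : ℝ) := by
    intro r hr
    have h0 : (0 : ℝ) < r := hr
    rw [← Real.rpow_mul h0.le, Real.rpow_neg_one, joukowsky_inv,
      show (-(3 / 2) : ℝ) = ((-1 : ℝ) - 1) + (-1) * -(1 / 2) by norm_num, Real.rpow_add h0]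
    simp only [abs_neg, abs_one, one_mul, smul_eq_mul]
    ring
  constructor
  · refine IntegrableOn.congr_fun ?_ he measurableSet_Ioi
    exact (integrableOn_Ioi_comp_rpow_iff
      (fun r => legendreQ l (joukowsky r) * r ^ (-(1 / 2) : ℝ)) (by norm_num)).2
      (integrableOn_legendreQ_rpow l)
  · rw [← setIntegral_congr_fun measurableSet_Ioi he]
    exact integral_comp_rpow_Ioi (fun r => legendreQ l (joukowsky r) * r ^ (-(1 / 2) : ℝ))
      (by norm_num)

/-! ### Energy and spinor coefficients -/

section Coefficients

variable {c m : ℝ}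

theorem energy_zero_eq (hc : 0 < c) (hm : 0 < m) : energy c m 0 = m * c ^ 2 := by
  rw [energy, show c ^ 2 * 0 ^ 2 + m ^ 2 * c ^ 4 = (m * c ^ 2) ^ 2 by ring,
    Real.sqrt_sq (by positivity)]

theorem energy_sq (hc : 0 < c) (hm : 0 < m) (p : ℝ) :
    energy c m p ^ 2 = c ^ 2 * p ^ 2 + energy c m 0 ^ 2 := by
  rw [energy_zero_eq hc hm, energy, Real.sq_sqrt (by positivity)]
  ring

theorem energy_pos (hc : 0 < c) (hm : 0 < m) (p : ℝ) : 0 < energy c m p :=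
  Real.sqrt_pos.2 (by positivity)

theorem energy_zero_lt (hc : 0 < c) (hm : 0 < m) {p : ℝ} (hp : 0 < p) :
    energy c m 0 < energy c m p := by
  have h := energy_sq hc hm p
  have h1 : 0 < c ^ 2 * p ^ 2 := by positivity
  nlinarith [energy_pos hc hm p, energy_pos hc hm 0]

theorem mul_le_energy (hc : 0 < c) (hm : 0 < m) (p : ℝ) : c * p ≤ energy c m p := by
  have h := energy_sq hc hm p
  nlinarith [energy_pos hc hm p, energy_pos hc hm 0]

theorem energy_le (hc : 0 < c) (hm : 0 < m) {p : ℝ} (hp : 0 ≤ p) :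
    energy c m p ≤ c * p + energy c m 0 := by
  have h := energy_sq hc hm p
  have h1 : 0 ≤ c * p := by positivity
  nlinarith [energy_pos hc hm p, energy_pos hc hm 0]

theorem measurable_energy (c m : ℝ) : Measurable (energy c m) := by
  unfold energy
  fun_prop

theorem hasDerivAt_energy (hc : 0 < c) (hm : 0 < m) (p : ℝ) :
    HasDerivAt (energy c m) (c ^ 2 * p / energy c m p) p := by
  have h : HasDerivAt (fun p : ℝ => c ^ 2 * p ^ 2 + m ^ 2 * c ^ 4) (c ^ 2 * (2 * p)) p := by
    simpa using ((hasDerivAt_pow 2 p).const_mul (c ^ 2)).add_const (m ^ 2 * c ^ 4)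
  refine (h.sqrt (by positivity)).congr_deriv ?_
  change _ / (2 * energy c m p) = _
  field_simp

/-- The ratio `e(0) / e(p)`. -/
noncomputable def restRatio (c m p : ℝ) : ℝ := energy c m 0 / energy c m p

theorem measurable_restRatio (c m : ℝ) : Measurable (restRatio c m) :=
  (measurable_energy c m).const_div _

theorem restRatio_pos (hc : 0 < c) (hm : 0 < m) (p : ℝ) : 0 < restRatio c m p :=
  div_pos (energy_pos hc hm 0) (energy_pos hc hm p)

theorem restRatio_le_one (hc : 0 < c) (hm : 0 < m) (p : ℝ) : restRatio c m p ≤ 1 :=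
  (div_le_one (energy_pos hc hm p)).2 (energy_zero_le c m p)

theorem restRatio_lt_one (hc : 0 < c) (hm : 0 < m) {p : ℝ} (hp : 0 < p) : restRatio c m p < 1 :=
  (div_lt_one (energy_pos hc hm p)).2 (energy_zero_lt hc hm hp)

theorem one_sub_restRatio_sq (hc : 0 < c) (hm : 0 < m) (p : ℝ) :
    1 - restRatio c m p ^ 2 = (c * p / energy c m p) ^ 2 := by
  have h := energy_sq hc hm p
  have he := (energy_pos hc hm p).ne'
  unfold restRatio
  field_simp
  linarith

/-- From `p e'/e = (cp/e)² = 1 - x²`: the logarithmic dilation derivative of `x` is a polynomial in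
`x`, and the coefficients inherit this. -/
theorem hasDerivAt_restRatio (hc : 0 < c) (hm : 0 < m) {p : ℝ} (hp : 0 < p) :
    HasDerivAt (restRatio c m) (-(restRatio c m p * (1 - restRatio c m p ^ 2) / p)) p := by
  have he := (energy_pos hc hm p).ne'
  refine ((hasDerivAt_energy hc hm p).fun_inv he |>.const_mul (energy c m 0)).congr_deriv ?_
  rw [one_sub_restRatio_sq hc hm, restRatio]
  field_simp

/-- The coefficient of the upper spinor component. -/
noncomputable def coefUpper (c m p : ℝ) : ℝ := (energy c m p + energy c m 0) / normFactor c m p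

/-- The coefficient of the lower spinor component. -/
noncomputable def coefLower (c m p : ℝ) : ℝ := c * p / normFactor c m p

theorem measurable_normFactor (c m : ℝ) : Measurable (normFactor c m) := by
  unfold normFactor energy
  fun_prop

theorem measurable_coefLower (c m : ℝ) : Measurable (coefLower c m) :=
  (measurable_const.mul measurable_id).div (measurable_normFactor c m)

theorem coefUpper_eq_sqrt (hc : 0 < c) (hm : 0 < m) (p : ℝ) :
    coefUpper c m p = √((1 + restRatio c m p) / 2) := by
  have he := energy_pos hc hm p
  have h0 := energy_pos hc hm 0
  rw [← Real.sqrt_sq (show 0 ≤ coefUpper c m p from div_nonneg (by positivity) (Real.sqrt_nonneg _))]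
  congr 1
  rw [coefUpper, normFactor, div_pow, Real.sq_sqrt (by positivity), restRatio]
  field_simp

theorem coefLower_eq_sqrt (hc : 0 < c) (hm : 0 < m) {p : ℝ} (hp : 0 ≤ p) :
    coefLower c m p = √((1 - restRatio c m p) / 2) := by
  have he := energy_pos hc hm p
  have h0 := energy_pos hc hm 0
  rw [← Real.sqrt_sq (show 0 ≤ coefLower c m p from div_nonneg (by positivity) (Real.sqrt_nonneg _))]
  congr 1
  rw [coefLower, normFactor, div_pow, Real.sq_sqrt (by positivity), restRatio]
  have := energy_sq hc hm p
  field_simp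
  linarith

theorem coefLower_nonneg (hc : 0 < c) {p : ℝ} (hp : 0 ≤ p) : 0 ≤ coefLower c m p :=
  div_nonneg (by positivity) (Real.sqrt_nonneg _)

theorem coefLower_sq (hc : 0 < c) (hm : 0 < m) {p : ℝ} (hp : 0 ≤ p) :
    coefLower c m p ^ 2 = (1 - restRatio c m p) / 2 := by
  rw [coefLower_eq_sqrt hc hm hp, Real.sq_sqrt]
  linarith [restRatio_le_one hc hm p]

/-- Since the square of the coefficient is `(1 + x)/2`, twice its logarithmic dilation derivative is
`-x(1 - x²)/(1 + x) = -(x - x²)`. The lower coefficient, with square `(1 - x)/2`, gives `x + x²` in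
the same way. -/
theorem hasDerivAt_coefUpper (hc : 0 < c) (hm : 0 < m) {p : ℝ} (hp : 0 < p) :
    HasDerivAt (coefUpper c m)
      (-((restRatio c m p - restRatio c m p ^ 2) / 2) * coefUpper c m p / p) p := by
  have hx := restRatio_pos hc hm p
  rw [funext (coefUpper_eq_sqrt hc hm)]
  have hpos : 0 < (1 + restRatio c m p) / 2 := by positivity
  refine ((((hasDerivAt_restRatio hc hm hp).const_add 1).div_const 2).sqrt hpos.ne').congr_deriv ?_
  have hs := Real.sq_sqrt hpos.le
  have hs0 := Real.sqrt_pos.2 hpos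
  set s := √((1 + restRatio c m p) / 2)
  set x := restRatio c m p
  rw [div_eq_div_iff (by positivity) (by positivity)]
  have hxs : x = 2 * s ^ 2 - 1 := by linarith
  rw [hxs]
  field_simp
  ring

theorem hasDerivAt_coefLower (hc : 0 < c) (hm : 0 < m) {p : ℝ} (hp : 0 < p) :
    HasDerivAt (coefLower c m)
      ((restRatio c m p + restRatio c m p ^ 2) / 2 * coefLower c m p / p) p := by
  have hx := restRatio_lt_one hc hm hp
  have hev : coefLower c m =ᶠ[𝓝 p] fun p => √((1 - restRatio c m p) / 2) := by
    filter_upwards [lt_mem_nhds hp] with q hq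
    exact coefLower_eq_sqrt hc hm (le_of_lt hq)
  rw [coefLower_eq_sqrt hc hm hp.le]
  refine HasDerivAt.congr_of_eventuallyEq ?_ hev
  have hpos : 0 < (1 - restRatio c m p) / 2 := by linarith
  refine ((((hasDerivAt_restRatio hc hm hp).const_sub 1).div_const 2).sqrt hpos.ne').congr_deriv ?_
  have hs := Real.sq_sqrt hpos.le
  have hs0 := Real.sqrt_pos.2 hpos
  set s := √((1 - restRatio c m p) / 2)
  set x := restRatio c m p
  rw [div_eq_div_iff (by positivity) (by positivity)]
  have hxs : x = 1 - 2 * s ^ 2 := by linarith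
  rw [hxs]
  field_simp
  ring

/-- The dilation derivative of `θ a(θ p') a(θ p)` for a function `a` with logarithmic
derivative `b`. -/
theorem hasDerivAt_dilation_mul {a b : ℝ → ℝ} (ha : ∀ p, 0 < p → HasDerivAt a (b p * a p / p) p)
    {p' p θ : ℝ} (hp' : 0 < p') (hp : 0 < p) (hθ : 0 < θ) :
    HasDerivAt (fun θ : ℝ => θ * (a (θ * p') * a (θ * p)))
      (a (θ * p') * a (θ * p) * (1 + b (θ * p') + b (θ * p))) θ := by
  have h : ∀ q, 0 < q → HasDerivAt (fun θ : ℝ => a (θ * q)) (b (θ * q) * a (θ * q) / θ) θ := by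
    intro q hq
    have := (ha (θ * q) (mul_pos hθ hq)).comp θ ((hasDerivAt_id θ).mul_const q)
    refine this.congr_deriv ?_
    field_simp
  refine ((hasDerivAt_id θ).fun_mul ((h p' hp').fun_mul (h p hp))).congr_deriv ?_
  simp only [id_eq]
  field_simp
  ring

/-- Mean value inequality in `θ` on `(0, ∞)`; the constant is `1 + 1 + 1` from the factor `1 + b +
b`. Uniformity in `θ` and in the momenta is what later permits dominated convergence. -/
theorem abs_dilation_mul_sub_le {a b : ℝ → ℝ} (ha : ∀ p, 0 < p → HasDerivAt a (b p * a p / p) p)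
    (ha1 : ∀ p, 0 < p → |a p| ≤ 1) (hb1 : ∀ p, 0 < p → |b p| ≤ 1)
    {p' p θ : ℝ} (hp' : 0 < p') (hp : 0 < p) (hθ : 0 < θ) :
    |θ * (a (θ * p') * a (θ * p)) - a p' * a p| ≤ 3 * |θ - 1| := by
  have := (convex_Ioi (0 : ℝ)).norm_image_sub_le_of_norm_hasDerivWithin_le (C := 3)
    (f := fun θ : ℝ => θ * (a (θ * p') * a (θ * p))) (x := 1) (y := θ)
    (fun t ht => (hasDerivAt_dilation_mul ha hp' hp ht).hasDerivWithinAt) (fun t ht => ?_)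
    (mem_Ioi.2 one_pos) hθ
  · simpa using this
  · have h1 := mul_pos (mem_Ioi.1 ht) hp'
    have h2 := mul_pos (mem_Ioi.1 ht) hp
    rw [Real.norm_eq_abs, abs_mul, abs_mul]
    have e1 : |1 + b (t * p') + b (t * p)| ≤ 3 := by
      have := abs_le.1 (hb1 _ h1)
      have := abs_le.1 (hb1 _ h2)
      rw [abs_le]
      constructor <;> linarith
    have e2 := mul_le_one₀ (ha1 _ h1) (abs_nonneg _) (ha1 _ h2)
    calc _ ≤ 1 * 3 := mul_le_mul e2 e1 (abs_nonneg _) zero_le_one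
      _ = 3 := one_mul 3

/-! ### The kernel, its majorant and its difference quotients under dilations. -/

theorem kernel_eq (c m : ℝ) (l : ℕ) (s : Spin) (p' p : ℝ) :
    kernel c m l s p' p = legendreQ l (joukowsky (p' / p)) * (coefUpper c m p' * coefUpper c m p)
      + legendreQ (s.shift l) (joukowsky (p' / p)) * (coefLower c m p' * coefLower c m p) := by
  simp only [kernel, coefUpper, coefLower, joukowsky, inv_div]
  simp only [div_eq_mul_inv, mul_inv]
  ring

theorem kernel_symm (c m : ℝ) (l : ℕ) (s : Spin) (p' p : ℝ) :
    kernel c m l s p' p = kernel c m l s p p' := by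
  rw [kernel_eq, kernel_eq, ← joukowsky_inv (p' / p), inv_div]
  ring

/-- The function of scale-invariant ratio dominating all kernels. -/
noncomputable def kernelMajorant (p' p : ℝ) : ℝ := kernelWeight (p / p') * (p / p')

theorem kernelMajorant_nonneg {p' p : ℝ} (hp' : 0 < p') (hp : 0 < p) : 0 ≤ kernelMajorant p' p :=
  mul_nonneg (kernelWeight_nonneg (div_pos hp hp')) (div_pos hp hp').le

theorem exists_legendreQ_majorant : ∃ C : ℝ, 0 ≤ C ∧ ∀ (l : ℕ) (p' p : ℝ), 0 < p' → 0 < p →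
    p' ≠ p → |legendreQ l (joukowsky (p' / p))| ≤ C * kernelMajorant p' p := by
  obtain ⟨C, hC, hQ⟩ := exists_legendreQ_bound
  refine ⟨C, hC, fun l p' p hp' hp hne => ?_⟩
  have h1 : p / p' ≠ 1 := fun h => hne ((div_eq_one_iff_eq hp'.ne').1 h).symm
  have h0 := div_pos hp hp'
  rw [← joukowsky_inv, inv_div, kernelMajorant, kernelWeight, div_mul_cancel₀ _ h0.ne',
    ← joukowsky_sub_one h0]
  exact hQ l _ (one_lt_joukowsky h0 h1)

/-- The difference quotient of the kernel along dilations. -/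
noncomputable def kernelQuotient (c m : ℝ) (l : ℕ) (s : Spin) (θ p' p : ℝ) : ℝ :=
  (θ * kernel c m l s (θ * p') (θ * p) - kernel c m l s p' p) / (θ - 1)

/-- The dilation derivative of the kernel. -/
noncomputable def virialKernel (c m : ℝ) (l : ℕ) (s : Spin) (p' p : ℝ) : ℝ :=
  kernel c m l s p' p * (1 + (restRatio c m p' ^ 2 - restRatio c m p') / 2
      + (restRatio c m p ^ 2 - restRatio c m p) / 2)
    + (restRatio c m p' + restRatio c m p)
      * (legendreQ (s.shift l) (joukowsky (p' / p)) * (coefLower c m p' * coefLower c m p))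

theorem abs_coefUpper_log_deriv_le (hc : 0 < c) (hm : 0 < m) (p : ℝ) :
    |-((restRatio c m p - restRatio c m p ^ 2) / 2)| ≤ 1 := by
  have h0 := restRatio_pos hc hm p
  have h1 := restRatio_le_one hc hm p
  rw [abs_le]
  constructor <;> nlinarith

theorem abs_coefLower_log_deriv_le (hc : 0 < c) (hm : 0 < m) (p : ℝ) :
    |(restRatio c m p + restRatio c m p ^ 2) / 2| ≤ 1 := by
  have h0 := restRatio_pos hc hm p
  have h1 := restRatio_le_one hc hm p
  rw [abs_le]
  constructor <;> nlinarith

theorem kernel_dilation_sub (c m : ℝ) (l : ℕ) (s : Spin) {θ p' p : ℝ} (hθ : 0 < θ) :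
    θ * kernel c m l s (θ * p') (θ * p) - kernel c m l s p' p
      = legendreQ l (joukowsky (p' / p)) * (θ * (coefUpper c m (θ * p') * coefUpper c m (θ * p))
          - coefUpper c m p' * coefUpper c m p)
        + legendreQ (s.shift l) (joukowsky (p' / p))
          * (θ * (coefLower c m (θ * p') * coefLower c m (θ * p))
            - coefLower c m p' * coefLower c m p) := by
  rw [kernel_eq, kernel_eq, mul_div_mul_left _ _ hθ.ne']
  ring

theorem exists_kernelQuotient_bound (hc : 0 < c) (hm : 0 < m) (l : ℕ) (s : Spin) :
    ∃ C : ℝ, 0 ≤ C ∧ ∀ θ p' p : ℝ, 0 < θ → 0 < p' → 0 < p → p' ≠ p →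
      |kernelQuotient c m l s θ p' p| ≤ C * kernelMajorant p' p := by
  obtain ⟨C, hC, hQ⟩ := exists_legendreQ_majorant
  -- Two Legendre terms, each with Lipschitz constant `3`.
  refine ⟨6 * C, by positivity, fun θ p' p hθ hp' hp hne => ?_⟩
  have hM : 0 ≤ C * kernelMajorant p' p := mul_nonneg hC (kernelMajorant_nonneg hp' hp)
  have q1 := hQ l p' p hp' hp hne
  have q2 := hQ (s.shift l) p' p hp' hp hne
  have d1 := abs_dilation_mul_sub_le (fun p hp => hasDerivAt_coefUpper hc hm hp)
    (fun p _ => energy_add_div_le c m p) (fun p _ => abs_coefUpper_log_deriv_le hc hm p) hp' hp hθ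
  have d2 := abs_dilation_mul_sub_le (fun p hp => hasDerivAt_coefLower hc hm hp)
    (fun p _ => mul_div_normFactor_le c m p) (fun p _ => abs_coefLower_log_deriv_le hc hm p)
    hp' hp hθ
  rw [kernelQuotient, kernel_dilation_sub c m l s hθ, abs_div]
  refine div_le_of_le_mul₀ (abs_nonneg _) (by nlinarith) ((abs_add_le _ _).trans ?_)
  rw [abs_mul, abs_mul]
  calc _ ≤ C * kernelMajorant p' p * (3 * |θ - 1|) + C * kernelMajorant p' p * (3 * |θ - 1|) := by
        gcongr
    _ = _ := by ring

theorem tendsto_kernelQuotient (hc : 0 < c) (hm : 0 < m) (l : ℕ) (s : Spin) {p' p : ℝ}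
    (hp' : 0 < p') (hp : 0 < p) :
    Tendsto (fun θ => kernelQuotient c m l s θ p' p) (𝓝[≠] 1)
      (𝓝 (virialKernel c m l s p' p)) := by
  have d1 := hasDerivAt_iff_tendsto_slope.1
    (hasDerivAt_dilation_mul (fun p hp => hasDerivAt_coefUpper hc hm hp) hp' hp one_pos)
  have d2 := hasDerivAt_iff_tendsto_slope.1
    (hasDerivAt_dilation_mul (fun p hp => hasDerivAt_coefLower hc hm hp) hp' hp one_pos)
  have h := (d1.const_mul (legendreQ l (joukowsky (p' / p)))).add
    (d2.const_mul (legendreQ (s.shift l) (joukowsky (p' / p))))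
  -- The lower term has logarithmic derivative `(x + x²)/2 = (x² - x)/2 + x` per variable. Thus the
  -- factor of the upper term can be extracted from the whole kernel, at the cost of the extra `(x'
  -- + x)` times the lower term.
  have hlim : virialKernel c m l s p' p = legendreQ l (joukowsky (p' / p))
      * (coefUpper c m p' * coefUpper c m p * (1 + -((restRatio c m p' - restRatio c m p' ^ 2) / 2)
        + -((restRatio c m p - restRatio c m p ^ 2) / 2)))
      + legendreQ (s.shift l) (joukowsky (p' / p))
      * (coefLower c m p' * coefLower c m p * (1 + (restRatio c m p' + restRatio c m p' ^ 2) / 2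
        + (restRatio c m p + restRatio c m p ^ 2) / 2)) := by
    rw [virialKernel, kernel_eq]
    ring
  rw [hlim]
  simp only [one_mul] at h
  refine h.congr' ?_
  filter_upwards [nhdsWithin_le_nhds (lt_mem_nhds one_pos)] with θ hθ
  rw [kernelQuotient, kernel_dilation_sub c m l s hθ, slope_def_field, slope_def_field]
  simp only [one_mul]
  ring

theorem measurable_kernelQuotient (c m : ℝ) (l : ℕ) (s : Spin) (θ : ℝ) :
    Measurable fun q : ℝ × ℝ => kernelQuotient c m l s θ q.1 q.2 := by
  have h1 := measurable_kernel c m l s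
  have hg : Measurable fun q : ℝ × ℝ => (θ * q.1, θ * q.2) := by fun_prop
  exact ((Measurable.const_mul (h1.comp hg) θ).sub h1).div_const (θ - 1)

/-- The difference quotient of the energy along dilations. -/
noncomputable def energyQuotient (c m θ p : ℝ) : ℝ :=
  (energy c m (θ * p) - energy c m p) / (θ - 1)

theorem hasDerivAt_energy_dilation (hc : 0 < c) (hm : 0 < m) (θ p : ℝ) :
    HasDerivAt (fun θ => energy c m (θ * p)) (c ^ 2 * (θ * p) / energy c m (θ * p) * p) θ := by
  have h : HasDerivAt (fun θ : ℝ => θ * p) p θ := by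
    simpa using (hasDerivAt_id θ).mul_const p
  exact HasDerivAt.comp (h₂ := energy c m) θ (hasDerivAt_energy hc hm (θ * p)) h

/-- The derivative in `θ` is `cp` times `c(θp)/e(θp)`, a factor of modulus at most one, so the mean
value inequality is uniform over all real `θ`. At `θ = 1` the quotient is zero by the convention for
division. -/
theorem abs_energyQuotient_le (hc : 0 < c) (hm : 0 < m) {θ p : ℝ} (hp : 0 ≤ p) :
    |energyQuotient c m θ p| ≤ c * p := by
  have := convex_univ.norm_image_sub_le_of_norm_hasDerivWithin_le (C := c * p)
    (f := fun θ : ℝ => energy c m (θ * p)) (x := 1) (y := θ)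
    (fun t _ => (hasDerivAt_energy_dilation hc hm t p).hasDerivWithinAt) (fun t _ => ?_)
    (mem_univ _) (mem_univ _)
  · rw [energyQuotient, abs_div]
    refine div_le_of_le_mul₀ (abs_nonneg _) (by positivity) ?_
    simpa using this
  · have he := energy_pos hc hm (t * p)
    have h1 : |c * (t * p)| ≤ energy c m (t * p) := by
      refine abs_le_of_sq_le_sq ?_ he.le
      rw [energy_sq hc hm]
      nlinarith [sq_nonneg (energy c m 0)]
    rw [show c ^ 2 * (t * p) / energy c m (t * p) * p
      = c * (t * p) / energy c m (t * p) * (c * p) by ring, norm_mul, Real.norm_eq_abs,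
      Real.norm_of_nonneg (by positivity : 0 ≤ c * p), abs_div, abs_of_pos he]
    exact mul_le_of_le_one_left (by positivity) (div_le_one_of_le₀ h1 he.le)

theorem tendsto_energyQuotient (hc : 0 < c) (hm : 0 < m) (p : ℝ) :
    Tendsto (fun θ => energyQuotient c m θ p) (𝓝[≠] 1)
      (𝓝 (energy c m p - energy c m 0 * restRatio c m p)) := by
  have h := hasDerivAt_iff_tendsto_slope.1 (hasDerivAt_energy_dilation hc hm 1 p)
  have hl : c ^ 2 * (1 * p) / energy c m (1 * p) * p
      = energy c m p - energy c m 0 * restRatio c m p := by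
    have := energy_sq hc hm p
    have he := (energy_pos hc hm p).ne'
    rw [restRatio, one_mul]
    field_simp
    linarith
  rw [hl] at h
  refine h.congr fun θ => ?_
  rw [slope_def_field, energyQuotient, one_mul]

end Coefficients

/-! ### Weighted square integrable functions and dilations -/

/-- Representatives of elements of the form domain. -/
structure WeightedL2 (f : ℝ → ℂ) : Prop where
  stronglyMeasurable : StronglyMeasurable f
  integrable : Integrable (fun p => (1 + p) * ‖f p‖ ^ 2) halfLine

/-- The squared norm of the form domain. -/
noncomputable def weightedSq (f : ℝ → ℂ) : ℝ := ∫ p, (1 + p) * ‖f p‖ ^ 2 ∂halfLine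

theorem ae_halfLine_pos : ∀ᵐ p ∂halfLine, 0 < p := ae_restrict_mem measurableSet_Ioi

theorem weightedSq_nonneg (f : ℝ → ℂ) : 0 ≤ weightedSq f := by
  refine integral_nonneg_of_ae ?_
  filter_upwards [ae_halfLine_pos] with p hp
  positivity

theorem norm_sub_sq_le (a b : ℂ) : ‖a - b‖ ^ 2 ≤ 2 * (‖a‖ ^ 2 + ‖b‖ ^ 2) := by
  have := norm_sub_le a b
  nlinarith [sq_nonneg (‖a‖ - ‖b‖), norm_nonneg (a - b)]

theorem WeightedL2.of_norm_sq_le {f : ℝ → ℂ} {g : ℝ → ℝ} (hf : StronglyMeasurable f)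
    (hg : Integrable (fun p => (1 + p) * g p) halfLine) (h : ∀ p, ‖f p‖ ^ 2 ≤ g p) :
    WeightedL2 f := by
  refine ⟨hf, hg.mono' ?_ ?_⟩
  · exact ((by fun_prop : Measurable fun p : ℝ => 1 + p).stronglyMeasurable.mul
      (hf.norm.pow 2)).aestronglyMeasurable
  · filter_upwards [ae_halfLine_pos] with p hp
    rw [Real.norm_of_nonneg (by positivity)]
    exact mul_le_mul_of_nonneg_left (h p) (by positivity)

theorem WeightedL2.sub {f g : ℝ → ℂ} (hf : WeightedL2 f) (hg : WeightedL2 g) :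
    WeightedL2 (fun p => f p - g p) := by
  refine .of_norm_sq_le (hf.1.sub hg.1) ?_ fun p => norm_sub_sq_le (f p) (g p)
  refine ((hf.2.add hg.2).const_mul 2).congr (.of_forall fun p => ?_)
  simp only [Pi.add_apply]
  ring

theorem weightedSq_sub_le {f g : ℝ → ℂ} (hf : WeightedL2 f) (hg : WeightedL2 g) :
    weightedSq (fun p => f p - g p) ≤ 2 * (weightedSq f + weightedSq g) := by
  unfold weightedSq
  rw [← integral_add hf.2 hg.2, ← integral_const_mul]
  refine integral_mono_ae (hf.sub hg).2 ((hf.2.add hg.2).const_mul 2) ?_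
  filter_upwards [ae_halfLine_pos] with p hp
  have := mul_le_mul_of_nonneg_left (norm_sub_sq_le (f p) (g p)) (show 0 ≤ 1 + p by positivity)
  linarith

theorem WeightedL2.mul_bounded {f : ℝ → ℂ} (hf : WeightedL2 f) {w : ℝ → ℝ} (hw : Measurable w)
    {B : ℝ} (hB : ∀ p, |w p| ≤ B) : WeightedL2 (fun p => (w p : ℂ) * f p) := by
  refine .of_norm_sq_le (g := fun p => B ^ 2 * ‖f p‖ ^ 2)
    ((Complex.measurable_ofReal.comp hw).stronglyMeasurable.mul hf.1) ?_ fun p => ?_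
  · refine (hf.2.const_mul (B ^ 2)).congr (.of_forall fun p => ?_)
    ring
  · rw [norm_mul, mul_pow, Complex.norm_real, Real.norm_eq_abs]
    have := hB p
    gcongr

theorem integrable_halfLine_comp_mul {E : Type*} [NormedAddCommGroup E] {f : ℝ → E} {θ : ℝ}
    (hθ : 0 < θ) : Integrable (fun p => f (θ * p)) halfLine ↔ Integrable f halfLine := by
  have := integrableOn_Ioi_comp_mul_left_iff f 0 hθ
  rwa [mul_zero] at this

theorem integral_halfLine_comp_mul {E : Type*} [NormedAddCommGroup E] [NormedSpace ℝ E]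
    (f : ℝ → E) {θ : ℝ} (hθ : 0 < θ) :
    ∫ p, f (θ * p) ∂halfLine = θ⁻¹ • ∫ p, f p ∂halfLine := by
  have := integral_comp_mul_left_Ioi f 0 hθ
  rwa [mul_zero] at this

theorem dilation_weight_le {f : ℝ → ℂ} {θ p : ℝ} (hθ : 1 / 2 ≤ θ) (hp : 0 < p) :
    (1 + p) * ‖f (θ * p)‖ ^ 2 ≤ 2 * ((1 + θ * p) * ‖f (θ * p)‖ ^ 2) := by
  have : 1 + p ≤ 2 * (1 + θ * p) := by nlinarith
  have := mul_le_mul_of_nonneg_right this (sq_nonneg ‖f (θ * p)‖)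
  linarith

theorem WeightedL2.dilate {f : ℝ → ℂ} (hf : WeightedL2 f) {θ : ℝ} (hθ : 0 < θ) :
    WeightedL2 (fun p => f (θ * p)) := by
  have hi := (integrable_halfLine_comp_mul hθ).2 hf.2
  have hm : StronglyMeasurable fun p => f (θ * p) := hf.1.comp_measurable (by fun_prop)
  refine ⟨hm, (hi.const_mul (1 + θ⁻¹)).mono' ?_ ?_⟩
  · exact ((by fun_prop : Measurable fun p : ℝ => 1 + p).stronglyMeasurable.mul
      (hm.norm.pow 2)).aestronglyMeasurable
  · filter_upwards [ae_halfLine_pos] with p hp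
    rw [Real.norm_of_nonneg (by positivity), ← mul_assoc]
    refine mul_le_mul_of_nonneg_right ?_ (sq_nonneg _)
    have h1 : (1 + θ⁻¹) * (1 + θ * p) = 1 + p + (θ * p + θ⁻¹) := by
      field_simp
      ring
    rw [h1]
    have : 0 < θ * p + θ⁻¹ := by positivity
    linarith

theorem weightedSq_dilate_le {f : ℝ → ℂ} (hf : WeightedL2 f) {θ : ℝ} (hθ : 1 / 2 ≤ θ) :
    weightedSq (fun p => f (θ * p)) ≤ 4 * weightedSq f := by
  have h0 : 0 < θ := by linarith
  have hi := (integrable_halfLine_comp_mul h0).2 hf.2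
  calc weightedSq (fun p => f (θ * p))
      ≤ ∫ p, 2 * ((1 + θ * p) * ‖f (θ * p)‖ ^ 2) ∂halfLine := by
        refine integral_mono_ae (hf.dilate h0).2 (hi.const_mul 2) ?_
        filter_upwards [ae_halfLine_pos] with p hp
        exact dilation_weight_le hθ hp
    _ = 2 * (θ⁻¹ * weightedSq f) := by
        rw [integral_const_mul, integral_halfLine_comp_mul (fun p => (1 + p) * ‖f p‖ ^ 2) h0,
          smul_eq_mul, weightedSq]
    _ ≤ 2 * (2 * weightedSq f) := by
        have : θ⁻¹ ≤ 2 := by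
          rw [inv_le_comm₀ h0 two_pos]
          linarith
        have := weightedSq_nonneg f
        gcongr
    _ = _ := by ring

theorem WeightedL2.of_continuous {g : ℝ → ℂ} (hg : Continuous g) (hs : HasCompactSupport g) :
    WeightedL2 g := by
  refine ⟨hg.stronglyMeasurable, Integrable.restrict ?_⟩
  refine Continuous.integrable_of_hasCompactSupport (by fun_prop) ?_
  refine hs.mono fun p hp => ?_
  rw [Function.mem_support] at hp ⊢
  intro h
  exact hp (by rw [h]; simp)

/-- Functions in the weighted space are approximated by continuous ones with compact support. -/
theorem WeightedL2.exists_continuous_approx {f : ℝ → ℂ} (hf : WeightedL2 f) {ε : ℝ} (hε : 0 < ε) :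
    ∃ g : ℝ → ℂ, Continuous g ∧ HasCompactSupport g ∧ weightedSq (fun p => f p - g p) ≤ ε := by
  -- Multiplication by `√(1 + |p|)` reduces the claim to density in unweighted `L²`. The absolute
  -- value keeps the weight positive and continuous on the whole line, so division by it preserves
  -- continuity and compact support.
  have hsq : Measurable fun p : ℝ => ((√(1 + |p|) : ℝ) : ℂ) := by fun_prop
  have hpos : ∀ p : ℝ, 0 < √(1 + |p|) := fun p => Real.sqrt_pos.2 (by positivity)
  have hne : ∀ p : ℝ, ((√(1 + |p|) : ℝ) : ℂ) ≠ 0 := fun p =>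
    Complex.ofReal_ne_zero.2 (hpos p).ne'
  have hm : AEStronglyMeasurable (fun p => ((√(1 + |p|) : ℝ) : ℂ) * f p) halfLine :=
    (hsq.stronglyMeasurable.mul hf.1).aestronglyMeasurable
  have hF : MemLp (fun p => ((√(1 + |p|) : ℝ) : ℂ) * f p) (ENNReal.ofReal 2) halfLine := by
    rw [show ENNReal.ofReal 2 = 2 by simp]
    refine (memLp_two_iff_integrable_sq_norm hm).2 (hf.2.congr ?_)
    filter_upwards [ae_halfLine_pos] with p hp
    rw [norm_mul, mul_pow, Complex.norm_real, Real.norm_of_nonneg (hpos p).le,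
      Real.sq_sqrt (by positivity), abs_of_pos hp]
  obtain ⟨G, hGs, hGi, hGc, -⟩ := hF.exists_hasCompactSupport_integral_rpow_sub_le two_pos hε
  refine ⟨fun p => (((√(1 + |p|))⁻¹ : ℝ) : ℂ) * G p, ?_, hGs.mul_left, ?_⟩
  · refine Continuous.mul (Complex.continuous_ofReal.comp ?_) hGc
    exact Continuous.inv₀ (by fun_prop) fun p => (hpos p).ne'
  · refine le_of_eq_of_le (integral_congr_ae ?_) hGi
    filter_upwards [ae_halfLine_pos] with p hp
    have h1 : ((√(1 + |p|) : ℝ) : ℂ) * f p - G p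
        = ((√(1 + |p|) : ℝ) : ℂ) * (f p - (((√(1 + |p|))⁻¹ : ℝ) : ℂ) * G p) := by
      push_cast
      field_simp [hne p]
    rw [h1, norm_mul, Real.mul_rpow (norm_nonneg _) (norm_nonneg _), Complex.norm_real,
      Real.norm_of_nonneg (hpos p).le, Real.rpow_two, Real.rpow_two, Real.sq_sqrt (by positivity),
      abs_of_pos hp]

theorem tendsto_weightedSq_dilate_of_continuous {g : ℝ → ℂ} (hg : Continuous g)
    (hs : HasCompactSupport g) :
    Tendsto (fun θ => weightedSq (fun p => g (θ * p) - g p)) (𝓝 1) (𝓝 0) := by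
  obtain ⟨M, hM⟩ := hg.bounded_above_of_compact_support hs
  obtain ⟨R, hR⟩ := hs.isCompact.isBounded.subset_closedBall (0 : ℝ)
  have hzero : ∀ p, R < |p| → g p = 0 := by
    intro p hp
    refine image_eq_zero_of_notMem_tsupport fun h => ?_
    have := hR h
    rw [mem_closedBall_zero_iff, Real.norm_eq_abs] at this
    linarith
  have hlim : (0 : ℝ) = ∫ p, (1 + p) * ‖g (1 * p) - g p‖ ^ 2 ∂halfLine := by simp
  rw [hlim]
  refine tendsto_integral_filter_of_dominated_convergence
    (fun p => (Icc (-(2 * |R|)) (2 * |R|)).indicator (fun p => (1 + |p|) * (2 * M) ^ 2) p)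
    (.of_forall fun θ => (by fun_prop : Continuous fun p => (1 + p) * ‖g (θ * p) - g p‖ ^ 2)
      |>.aestronglyMeasurable) ?_ ?_ ?_
  · filter_upwards [lt_mem_nhds (show (1 / 2 : ℝ) < 1 by norm_num)] with θ hθ
    filter_upwards [ae_halfLine_pos] with p hp
    rw [Real.norm_of_nonneg (by positivity)]
    by_cases h : p ∈ Icc (-(2 * |R|)) (2 * |R|)
    · rw [indicator_of_mem h, abs_of_pos hp]
      have : ‖g (θ * p) - g p‖ ≤ 2 * M := by
        have := norm_sub_le (g (θ * p)) (g p)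
        linarith [hM (θ * p), hM p]
      gcongr
    · rw [indicator_of_notMem h]
      have h2 : 2 * |R| < p := by
        by_contra hc
        exact h ⟨by linarith [abs_nonneg R], not_lt.1 hc⟩
      have hRR := le_abs_self R
      rw [hzero p (by rw [abs_of_pos hp]; linarith [abs_nonneg R]),
        hzero (θ * p) (by rw [abs_of_pos (by positivity)]; nlinarith)]
      simp
  · refine Integrable.restrict ((integrable_indicator_iff measurableSet_Icc).2 ?_)
    exact (by fun_prop : Continuous fun p : ℝ => (1 + |p|) * (2 * M) ^ 2).integrableOn_Icc
  · refine .of_forall fun p => ?_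
    have : Continuous fun θ : ℝ => (1 + p) * ‖g (θ * p) - g p‖ ^ 2 := by fun_prop
    exact this.tendsto 1

/-- Dilations act continuously on the weighted space. -/
theorem WeightedL2.tendsto_dilate {f : ℝ → ℂ} (hf : WeightedL2 f) :
    Tendsto (fun θ => weightedSq (fun p => f (θ * p) - f p)) (𝓝 1) (𝓝 0) := by
  rw [Metric.tendsto_nhds]
  intro ε hε
  -- With `d = f - g`, the difference is `(d_θ - d) - (g - g_θ)`. The bounds below give `2(2(4 +
  -- 1)ε/40 + ε/8) = 3ε/4`.
  obtain ⟨g, hg, hs, hfg⟩ := hf.exists_continuous_approx (show 0 < ε / 40 by positivity)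
  have hgw := WeightedL2.of_continuous hg hs
  have h1 := (tendsto_weightedSq_dilate_of_continuous hg hs).eventually_lt_const
    (show 0 < ε / 8 by positivity)
  filter_upwards [h1, lt_mem_nhds (show (1 / 2 : ℝ) < 1 by norm_num)] with θ h1 hθ
  have h0 : 0 < θ := by linarith
  rw [Real.dist_eq, sub_zero, abs_of_nonneg (weightedSq_nonneg _)]
  have hd := hf.sub hgw
  have e1 := weightedSq_dilate_le hd hθ.le
  have e2 := weightedSq_sub_le (hd.dilate h0) hd
  have e3 := weightedSq_sub_le ((hd.dilate h0).sub hd) (hgw.sub (hgw.dilate h0))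
  have e4 : weightedSq (fun p => g p - g (θ * p)) = weightedSq (fun p => g (θ * p) - g p) := by
    simp only [weightedSq, norm_sub_rev]
  rw [e4] at e3
  have e5 : (fun p => f (θ * p) - f p)
      = fun p => (f (θ * p) - g (θ * p) - (f p - g p)) - (g p - g (θ * p)) := by
    funext p
    ring
  rw [e5]
  linarith

/-! ### Relation with the form domain -/

theorem sqrt_one_add_sq_le {p : ℝ} (hp : 0 < p) : √(1 + p ^ 2) ≤ 1 + p := by
  rw [Real.sqrt_le_left (by positivity)]
  nlinarith

theorem WeightedL2.of_mem_formDomain {u : RadialL2} (hu : u ∈ formDomain) : WeightedL2 u := by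
  have hu' : Integrable (fun p => √(1 + p ^ 2) * ‖u p‖ ^ 2) halfLine := hu
  have hm := Lp.stronglyMeasurable u
  refine ⟨hm, (hu'.const_mul 2).mono' ?_ ?_⟩
  · exact ((by fun_prop : Measurable fun p : ℝ => 1 + p).stronglyMeasurable.mul
      (hm.norm.pow 2)).aestronglyMeasurable
  · filter_upwards [ae_halfLine_pos] with p hp
    rw [Real.norm_of_nonneg (by positivity), ← mul_assoc]
    refine mul_le_mul_of_nonneg_right ?_ (sq_nonneg _)
    have : (1 + p) / 2 ≤ √(1 + p ^ 2) := Real.le_sqrt_of_sq_le (by nlinarith [sq_nonneg (p - 1)])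
    linarith

theorem WeightedL2.integrable_norm_sq {f : ℝ → ℂ} (hf : WeightedL2 f) :
    Integrable (fun p => ‖f p‖ ^ 2) halfLine := by
  refine hf.2.mono' (hf.1.norm.pow 2).aestronglyMeasurable ?_
  filter_upwards [ae_halfLine_pos] with p hp
  rw [Real.norm_of_nonneg (by positivity)]
  nlinarith [sq_nonneg ‖f p‖]

theorem WeightedL2.integrable_mul_norm_sq {f : ℝ → ℂ} (hf : WeightedL2 f) :
    Integrable (fun p => p * ‖f p‖ ^ 2) halfLine := by
  refine (hf.2.sub hf.integrable_norm_sq).congr (.of_forall fun p => ?_)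
  simp only [Pi.sub_apply]
  ring

/-- This makes dilates and bounded multiples of an eigenfunction admissible as test vectors while
they are handled as plain functions. -/
theorem WeightedL2.exists_mem_formDomain {f : ℝ → ℂ} (hf : WeightedL2 f) :
    ∃ v ∈ formDomain, (v : ℝ → ℂ) =ᵐ[halfLine] f := by
  have hm : MemLp f 2 halfLine :=
    (memLp_two_iff_integrable_sq_norm hf.1.aestronglyMeasurable).2 hf.integrable_norm_sq
  refine ⟨hm.toLp f, ?_, hm.coeFn_toLp⟩
  refine Integrable.mono' hf.2 ?_ ?_
  · exact (by fun_prop : Measurable fun p : ℝ => √(1 + p ^ 2)).aestronglyMeasurable.mul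
      ((Lp.aestronglyMeasurable _).norm.pow 2)
  · filter_upwards [ae_halfLine_pos, hm.coeFn_toLp] with p hp he
    rw [Real.norm_of_nonneg (by positivity), he]
    exact mul_le_mul_of_nonneg_right (sqrt_one_add_sq_le hp) (sq_nonneg _)

/-! ### Pairings with multipliers and kernels -/

/-- The pairing `∫ E(p) f̄(p) g(p) dp`. -/
noncomputable def multiplierPairing (E : ℝ → ℝ) (f g : ℝ → ℂ) : ℂ :=
  ∫ p, (E p : ℂ) * (conj (f p) * g p) ∂halfLine

/-- The pairing `∬ f̄(p') K(p', p) g(p) dp' dp`. -/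
noncomputable def kernelPairing (K : ℝ → ℝ → ℝ) (f g : ℝ → ℂ) : ℂ :=
  ∫ q : ℝ × ℝ, conj (f q.1) * (K q.1 q.2 : ℂ) * g q.2 ∂(halfLine.prod halfLine)

theorem ae_prod_halfLine :
    ∀ᵐ q ∂(halfLine.prod halfLine), 0 < q.1 ∧ 0 < q.2 ∧ q.1 ≠ q.2 := by
  have hne : ∀ᵐ q ∂(halfLine.prod halfLine), q.1 ≠ q.2 := by
    have hms : MeasurableSet {q : ℝ × ℝ | q.1 ≠ q.2} :=
      (measurableSet_eq_fun measurable_fst measurable_snd).compl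
    rw [Measure.ae_prod_iff_ae_ae hms]
    refine .of_forall fun a => ?_
    have : ∀ᵐ b ∂halfLine, b ≠ a := compl_mem_ae_iff.2 (measure_singleton a)
    filter_upwards [this] with b hb
    exact hb.symm
  have hpos : ∀ᵐ q ∂(halfLine.prod halfLine), q ∈ Ioi (0 : ℝ) ×ˢ Ioi (0 : ℝ) := by
    rw [Measure.prod_restrict]
    exact ae_restrict_mem (measurableSet_Ioi.prod measurableSet_Ioi)
  filter_upwards [hne, hpos] with q h1 h2
  exact ⟨h2.1, h2.2, h1⟩

theorem integral_halfLine_comp_div (φ : ℝ → ℝ) {a : ℝ} (ha : 0 < a) :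
    ∫ p, φ (p / a) ∂halfLine = a * ∫ p, φ p ∂halfLine := by
  simpa [div_eq_inv_mul] using integral_halfLine_comp_mul φ (inv_pos.2 ha)

theorem integrable_halfLine_comp_div {φ : ℝ → ℝ} (hφ : Integrable φ halfLine) {a : ℝ}
    (ha : 0 < a) : Integrable (fun p => φ (p / a)) halfLine := by
  simpa [div_eq_inv_mul] using (integrable_halfLine_comp_mul (inv_pos.2 ha)).2 hφ

/-- The substitution `r = p/p'` in the inner integral produces a factor `p'`, whence the first
moment of `ρ` in the hypothesis; the product integral then factorises. -/
theorem integrable_prod_comp_div {ρ φ : ℝ → ℝ} (hρ : Measurable ρ)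
    (hρi : Integrable (fun p => p * ρ p) halfLine) (hφ : Measurable φ)
    (hφi : Integrable φ halfLine) :
    Integrable (fun q : ℝ × ℝ => ρ q.1 * φ (q.2 / q.1)) (halfLine.prod halfLine) := by
  have hm : AEStronglyMeasurable (fun q : ℝ × ℝ => ρ q.1 * φ (q.2 / q.1))
      (halfLine.prod halfLine) :=
    ((hρ.comp measurable_fst).mul
      (hφ.comp (measurable_snd.div measurable_fst))).aestronglyMeasurable
  rw [integrable_prod_iff hm]
  constructor
  · filter_upwards [ae_halfLine_pos] with a ha
    exact (integrable_halfLine_comp_div hφi ha).const_mul _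
  · refine (hρi.norm.mul_const (∫ p, ‖φ p‖ ∂halfLine)).congr ?_
    filter_upwards [ae_halfLine_pos] with a ha
    simp only [norm_mul]
    rw [integral_const_mul, integral_halfLine_comp_div (fun p => ‖φ p‖) ha,
      Real.norm_of_nonneg ha.le]
    ring

theorem integral_prod_comp_div {ρ φ : ℝ → ℝ} (hρ : Measurable ρ)
    (hρi : Integrable (fun p => p * ρ p) halfLine) (hφ : Measurable φ)
    (hφi : Integrable φ halfLine) :
    ∫ q : ℝ × ℝ, ρ q.1 * φ (q.2 / q.1) ∂(halfLine.prod halfLine)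
      = (∫ p, p * ρ p ∂halfLine) * ∫ p, φ p ∂halfLine := by
  rw [integral_prod _ (integrable_prod_comp_div hρ hρi hφ hφi), ← integral_mul_const]
  refine integral_congr_ae ?_
  filter_upwards [ae_halfLine_pos] with a ha
  rw [integral_const_mul, integral_halfLine_comp_div φ ha]
  ring

theorem kernelWeight_inv {r : ℝ} (hr : 0 < r) :
    kernelWeight r⁻¹ = kernelWeight r * r ^ 2 := by
  unfold kernelWeight
  rw [show (1 - r⁻¹) ^ 2 / (2 * r⁻¹) = (1 - r) ^ 2 / (2 * r) by field_simp; ring]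
  field_simp

theorem WeightedL2.integral_mul_norm_sq_le {f : ℝ → ℂ} (hf : WeightedL2 f) :
    ∫ p, p * ‖f p‖ ^ 2 ∂halfLine ≤ weightedSq f := by
  refine integral_mono hf.integrable_mul_norm_sq hf.2 fun p => ?_
  nlinarith [sq_nonneg ‖f p‖]

theorem WeightedL2.measurable_norm_sq {f : ℝ → ℂ} (hf : WeightedL2 f) :
    Measurable fun p => ‖f p‖ ^ 2 := (hf.1.norm.pow 2).measurable

/-! ### Kernel pairings: domination, symmetry and change of variables. -/

section Pairing

variable {K : ℝ → ℝ → ℝ} {C : ℝ} {f g : ℝ → ℂ}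

/-- The kernels considered: measurable and dominated by the majorant. -/
structure DominatedKernel (K : ℝ → ℝ → ℝ) (C : ℝ) : Prop where
  measurable : Measurable fun q : ℝ × ℝ => K q.1 q.2
  bound : ∀ p' p, 0 < p' → 0 < p → p' ≠ p → |K p' p| ≤ C * kernelMajorant p' p

theorem integrable_majorant_terms (hf : WeightedL2 f) (hg : WeightedL2 g) (t : ℝ) :
    Integrable (fun q : ℝ × ℝ => t * (‖f q.1‖ ^ 2 * kernelWeight (q.2 / q.1))
      + t⁻¹ * (‖g q.2‖ ^ 2 * kernelWeight (q.1 / q.2))) (halfLine.prod halfLine) :=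
  ((integrable_prod_comp_div hf.measurable_norm_sq hf.integrable_mul_norm_sq
    measurable_kernelWeight integrableOn_kernelWeight).const_mul t).add
  ((integrable_prod_comp_div hg.measurable_norm_sq hg.integrable_mul_norm_sq
    measurable_kernelWeight integrableOn_kernelWeight).swap.const_mul t⁻¹)

/-- With `r = p/p'` the majorant is `W(r) r`, and `W(r⁻¹) = W(r) r²`; Young's inequality for `a · (b
r)` therefore separates the two functions symmetrically. The free parameter `t` lets one side be
made small, playing the role of Cauchy–Schwarz. -/
theorem DominatedKernel.norm_le (hK : DominatedKernel K C) (hC : 0 ≤ C) {t : ℝ} (ht : 0 < t) :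
    ∀ᵐ q ∂(halfLine.prod halfLine), ‖conj (f q.1) * (K q.1 q.2 : ℂ) * g q.2‖
      ≤ C * (t * (‖f q.1‖ ^ 2 * kernelWeight (q.2 / q.1))
        + t⁻¹ * (‖g q.2‖ ^ 2 * kernelWeight (q.1 / q.2))) := by
  filter_upwards [ae_prod_halfLine] with q ⟨h1, h2, hne⟩
  have hr := div_pos h2 h1
  rw [norm_mul, norm_mul, RCLike.norm_conj, Complex.norm_real, Real.norm_eq_abs,
    ← inv_div q.2 q.1, kernelWeight_inv hr]
  have hb := hK.bound q.1 q.2 h1 h2 hne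
  have hw := kernelWeight_nonneg hr
  rw [kernelMajorant] at hb
  set r := q.2 / q.1
  set a := ‖f q.1‖
  set b := ‖g q.2‖
  have ha : 0 ≤ a := norm_nonneg _
  have hb0 : 0 ≤ b := norm_nonneg _
  have key : a * (b * r) ≤ t * a ^ 2 + t⁻¹ * (b * r) ^ 2 := by
    have e : t * a ^ 2 + t⁻¹ * (b * r) ^ 2 - a * (b * r)
        = t⁻¹ * ((t * a - b * r / 2) ^ 2 + 3 / 4 * (b * r) ^ 2) := by
      field_simp
      ring
    have : 0 ≤ t⁻¹ * ((t * a - b * r / 2) ^ 2 + 3 / 4 * (b * r) ^ 2) := by positivity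
    linarith
  calc a * |K q.1 q.2| * b ≤ a * (C * (kernelWeight r * r)) * b := by gcongr
    _ = C * kernelWeight r * (a * (b * r)) := by ring
    _ ≤ C * kernelWeight r * (t * a ^ 2 + t⁻¹ * (b * r) ^ 2) := by gcongr
    _ = _ := by ring

theorem DominatedKernel.aestronglyMeasurable (hK : DominatedKernel K C) (hf : WeightedL2 f)
    (hg : WeightedL2 g) :
    AEStronglyMeasurable (fun q : ℝ × ℝ => conj (f q.1) * (K q.1 q.2 : ℂ) * g q.2)
      (halfLine.prod halfLine) :=
  ((Complex.continuous_conj.comp_stronglyMeasurable (hf.1.comp_measurable measurable_fst)).mul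
    (Complex.measurable_ofReal.comp hK.measurable).stronglyMeasurable
    |>.mul (hg.1.comp_measurable measurable_snd)).aestronglyMeasurable

theorem DominatedKernel.integrable (hK : DominatedKernel K C) (hC : 0 ≤ C) (hf : WeightedL2 f)
    (hg : WeightedL2 g) :
    Integrable (fun q : ℝ × ℝ => conj (f q.1) * (K q.1 q.2 : ℂ) * g q.2)
      (halfLine.prod halfLine) :=
  ((integrable_majorant_terms hf hg 1).const_mul C).mono' (hK.aestronglyMeasurable hf hg)
    (hK.norm_le hC one_pos)

theorem DominatedKernel.norm_pairing_le (hK : DominatedKernel K C) (hC : 0 ≤ C)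
    (hf : WeightedL2 f) (hg : WeightedL2 g) {t : ℝ} (ht : 0 < t) :
    ‖kernelPairing K f g‖ ≤ t * (C * (∫ r, kernelWeight r ∂halfLine) * weightedSq f)
      + t⁻¹ * (C * (∫ r, kernelWeight r ∂halfLine) * weightedSq g) := by
  have hM : 0 ≤ ∫ r, kernelWeight r ∂halfLine :=
    setIntegral_nonneg measurableSet_Ioi fun r hr => kernelWeight_nonneg hr
  have h1 := integrable_prod_comp_div hf.measurable_norm_sq hf.integrable_mul_norm_sq
    measurable_kernelWeight integrableOn_kernelWeight
  have h2 := integrable_prod_comp_div hg.measurable_norm_sq hg.integrable_mul_norm_sq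
    measurable_kernelWeight integrableOn_kernelWeight
  have e2 : ∫ q : ℝ × ℝ, ‖g q.2‖ ^ 2 * kernelWeight (q.1 / q.2) ∂(halfLine.prod halfLine)
      = (∫ p, p * ‖g p‖ ^ 2 ∂halfLine) * ∫ r, kernelWeight r ∂halfLine := by
    rw [← integral_prod_comp_div hg.measurable_norm_sq hg.integrable_mul_norm_sq
      measurable_kernelWeight integrableOn_kernelWeight]
    exact integral_prod_swap
      (fun q : ℝ × ℝ => ‖g q.1‖ ^ 2 * kernelWeight (q.2 / q.1))
  refine (norm_integral_le_of_norm_le ((integrable_majorant_terms hf hg t).const_mul C)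
    (hK.norm_le hC ht)).trans ?_
  have h2s : Integrable (fun q : ℝ × ℝ => ‖g q.2‖ ^ 2 * kernelWeight (q.1 / q.2))
    (halfLine.prod halfLine) := h2.swap
  rw [integral_const_mul, integral_add (h1.const_mul t) (h2s.const_mul t⁻¹), integral_const_mul,
    integral_const_mul, e2, integral_prod_comp_div hf.measurable_norm_sq
      hf.integrable_mul_norm_sq measurable_kernelWeight integrableOn_kernelWeight]
  have f1 := hf.integral_mul_norm_sq_le
  have f2 := hg.integral_mul_norm_sq_le
  set M := ∫ r, kernelWeight r ∂halfLine
  calc _ = t * (C * M * ∫ p, p * ‖f p‖ ^ 2 ∂halfLine)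
        + t⁻¹ * (C * M * ∫ p, p * ‖g p‖ ^ 2 ∂halfLine) := by ring
    _ ≤ _ := by gcongr

theorem kernelPairing_conj (hs : ∀ p' p, K p' p = K p p') :
    conj (kernelPairing K f g) = kernelPairing K g f := by
  unfold kernelPairing
  rw [← integral_conj]
  refine (integral_prod_swap _).symm.trans (integral_congr_ae (.of_forall fun q => ?_))
  simp only [Prod.fst_swap, Prod.snd_swap, map_mul, Complex.conj_conj, Complex.conj_ofReal]
  rw [hs q.2 q.1]
  ring

theorem DominatedKernel.pairing_add_right (hK : DominatedKernel K C) (hC : 0 ≤ C)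
    (hf : WeightedL2 f) (hg : WeightedL2 g) :
    kernelPairing K f g = kernelPairing K f (fun p => g p - f p) + kernelPairing K f f := by
  unfold kernelPairing
  rw [← integral_add (hK.integrable hC hf (hg.sub hf)) (hK.integrable hC hf hf)]
  refine integral_congr_ae (.of_forall fun q => ?_)
  ring

theorem DominatedKernel.dilate (hK : DominatedKernel K C) {θ : ℝ} (hθ : 0 < θ) :
    DominatedKernel (fun p' p => K (θ * p') (θ * p)) C := by
  refine ⟨?_, fun p' p hp' hp hne => ?_⟩
  · have hg : Measurable fun q : ℝ × ℝ => (θ * q.1, θ * q.2) := by fun_prop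
    exact hK.measurable.comp hg
  · have := hK.bound (θ * p') (θ * p) (by positivity) (by positivity)
      fun h => hne (mul_left_cancel₀ hθ.ne' h)
    rwa [kernelMajorant, mul_div_mul_left _ _ hθ.ne'] at this

/-- Change of variables in a kernel pairing. -/
theorem DominatedKernel.pairing_dilate (hK : DominatedKernel K C) (hC : 0 ≤ C)
    (hf : WeightedL2 f) (hg : WeightedL2 g) {θ : ℝ} (hθ : 0 < θ) :
    kernelPairing K (fun p => f (θ⁻¹ * p)) g
      = θ ^ 2 * kernelPairing (fun p' p => K (θ * p') (θ * p)) f (fun p => g (θ * p)) := by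
  have hi := hK.integrable hC (hf.dilate (inv_pos.2 hθ)) hg
  have hi2 := (hK.dilate hθ).integrable hC hf (hg.dilate hθ)
  unfold kernelPairing
  rw [integral_prod _ hi, integral_prod _ hi2]
  simp only
  have h1 : ∀ p', ∫ p, conj (f p') * (K (θ * p') (θ * p) : ℂ) * g (θ * p) ∂halfLine
      = θ⁻¹ • ∫ p, conj (f p') * (K (θ * p') p : ℂ) * g p ∂halfLine := fun p' =>
    integral_halfLine_comp_mul (fun p => conj (f p') * (K (θ * p') p : ℂ) * g p) hθ
  have h2 : ∫ p', ∫ p, conj (f p') * (K (θ * p') p : ℂ) * g p ∂halfLine ∂halfLine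
      = θ⁻¹ • ∫ p', ∫ p, conj (f (θ⁻¹ * p')) * (K p' p : ℂ) * g p ∂halfLine ∂halfLine := by
    rw [← integral_halfLine_comp_mul
      (fun p' => ∫ p, conj (f (θ⁻¹ * p')) * (K p' p : ℂ) * g p ∂halfLine) hθ]
    simp only [inv_mul_cancel_left₀ hθ.ne']
  simp only [h1]
  rw [integral_smul, h2, Complex.real_smul, Complex.real_smul]
  have : (θ : ℂ) ≠ 0 := Complex.ofReal_ne_zero.2 hθ.ne'
  push_cast
  field_simp

end Pairing

/-- First `t` is fixed so small that `tA ≤ ε/2`, and only then is `N` taken small enough to absorb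
`t⁻¹`. -/
theorem tendsto_zero_of_forall_le {ι : Type*} {l : Filter ι} {F : ι → ℂ} {N : ι → ℝ} {A B : ℝ}
    (h : ∀ t, 0 < t → ∀ᶠ i in l, ‖F i‖ ≤ t * A + t⁻¹ * (B * N i)) (hN : Tendsto N l (𝓝 0)) :
    Tendsto F l (𝓝 0) := by
  rw [Metric.tendsto_nhds]
  intro ε hε
  have ht : 0 < ε / (2 * (|A| + 1)) := by positivity
  set t := ε / (2 * (|A| + 1)) with htd
  have hlim : Tendsto (fun i => t⁻¹ * (B * N i)) l (𝓝 0) := by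
    simpa using (hN.const_mul B).const_mul t⁻¹
  filter_upwards [h t ht, hlim.eventually_lt_const (half_pos hε)] with i h1 h2
  have hA : t * A ≤ ε / 2 := by
    have : t * (|A| + 1) = ε / 2 := by
      rw [htd]
      field_simp
    nlinarith [le_abs_self A]
  rw [dist_zero_right]
  linarith

/-- Continuity of kernel pairings along dilations. -/
theorem tendsto_kernelPairing_dilate {u : ℝ → ℂ} (hu : WeightedL2 u) {K : ℝ → ℝ → ℝ → ℝ}
    {K₀ : ℝ → ℝ → ℝ} {C : ℝ} (hC : 0 ≤ C) (hK : ∀ θ, 0 < θ → DominatedKernel (K θ) C)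
    (hlim : ∀ p' p, 0 < p' → 0 < p → Tendsto (fun θ => K θ p' p) (𝓝[≠] 1) (𝓝 (K₀ p' p))) :
    Tendsto (fun θ => kernelPairing (K θ) u (fun p => u (θ * p))) (𝓝[≠] 1)
      (𝓝 (kernelPairing K₀ u u)) := by
  have hpos : ∀ᶠ θ : ℝ in 𝓝[≠] 1, 0 < θ := nhdsWithin_le_nhds (lt_mem_nhds one_pos)
  -- Split `u(θ·) = u + (u(θ·) - u)`: the increment is controlled uniformly in the kernel by
  -- continuity of dilations, and with fixed `u` dominated convergence applies.
  have h1 : Tendsto (fun θ => kernelPairing (K θ) u (fun p => u (θ * p) - u p)) (𝓝[≠] 1)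
      (𝓝 0) := by
    refine tendsto_zero_of_forall_le (A := C * (∫ r, kernelWeight r ∂halfLine) * weightedSq u)
      (B := C * ∫ r, kernelWeight r ∂halfLine) (fun t ht => ?_)
      (hu.tendsto_dilate.mono_left nhdsWithin_le_nhds)
    filter_upwards [hpos] with θ hθ
    exact (hK θ hθ).norm_pairing_le hC hu ((hu.dilate hθ).sub hu) ht
  have h2 : Tendsto (fun θ => kernelPairing (K θ) u u) (𝓝[≠] 1) (𝓝 (kernelPairing K₀ u u)) := by
    refine tendsto_integral_filter_of_dominated_convergence _ ?_ ?_
      ((integrable_majorant_terms hu hu 1).const_mul C) ?_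
    · filter_upwards [hpos] with θ hθ
      exact (hK θ hθ).aestronglyMeasurable hu hu
    · filter_upwards [hpos] with θ hθ
      exact (hK θ hθ).norm_le hC one_pos
    · filter_upwards [ae_prod_halfLine] with q hq
      exact (((Complex.continuous_ofReal.tendsto _).comp (hlim q.1 q.2 hq.1 hq.2.1)).const_mul
        _).mul_const _
  have h3 := h1.add h2
  rw [zero_add] at h3
  refine h3.congr' ?_
  filter_upwards [hpos] with θ hθ
  exact ((hK θ hθ).pairing_add_right hC hu (hu.dilate hθ)).symm

/-! ### Multiplier pairings: the same estimates for the energy term. -/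

section Multiplier

variable {E : ℝ → ℝ} {B : ℝ} {f g : ℝ → ℂ}

theorem multiplier_norm_le (hB : 0 ≤ B) (hE : ∀ p, 0 < p → |E p| ≤ B * (1 + p)) {t : ℝ}
    (ht : 0 < t) : ∀ᵐ p ∂halfLine, ‖(E p : ℂ) * (conj (f p) * g p)‖
      ≤ B * (t * ((1 + p) * ‖f p‖ ^ 2) + t⁻¹ * ((1 + p) * ‖g p‖ ^ 2)) := by
  filter_upwards [ae_halfLine_pos] with p hp
  rw [norm_mul, norm_mul, RCLike.norm_conj, Complex.norm_real, Real.norm_eq_abs]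
  have h := hE p hp
  set a := ‖f p‖
  set b := ‖g p‖
  have ha : 0 ≤ a := norm_nonneg _
  have hb : 0 ≤ b := norm_nonneg _
  have key : a * b ≤ t * a ^ 2 + t⁻¹ * b ^ 2 := by
    have e : t * a ^ 2 + t⁻¹ * b ^ 2 - a * b
        = t⁻¹ * ((t * a - b / 2) ^ 2 + 3 / 4 * b ^ 2) := by
      field_simp
      ring
    have : 0 ≤ t⁻¹ * ((t * a - b / 2) ^ 2 + 3 / 4 * b ^ 2) := by positivity
    linarith
  calc |E p| * (a * b) ≤ (B * (1 + p)) * (t * a ^ 2 + t⁻¹ * b ^ 2) := by gcongr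
    _ = _ := by ring

theorem multiplier_aestronglyMeasurable (hm : Measurable E) (hf : WeightedL2 f)
    (hg : WeightedL2 g) :
    AEStronglyMeasurable (fun p => (E p : ℂ) * (conj (f p) * g p)) halfLine :=
  ((Complex.measurable_ofReal.comp hm).stronglyMeasurable.mul
    ((Complex.continuous_conj.comp_stronglyMeasurable hf.1).mul hg.1)).aestronglyMeasurable

theorem multiplier_integrable (hm : Measurable E) (hB : 0 ≤ B)
    (hE : ∀ p, 0 < p → |E p| ≤ B * (1 + p)) (hf : WeightedL2 f) (hg : WeightedL2 g) :
    Integrable (fun p => (E p : ℂ) * (conj (f p) * g p)) halfLine :=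
  (((hf.2.const_mul 1).add (hg.2.const_mul 1⁻¹)).const_mul B).mono'
    (multiplier_aestronglyMeasurable hm hf hg) (multiplier_norm_le hB hE one_pos)

theorem norm_multiplierPairing_le (hB : 0 ≤ B) (hE : ∀ p, 0 < p → |E p| ≤ B * (1 + p))
    (hf : WeightedL2 f) (hg : WeightedL2 g) {t : ℝ} (ht : 0 < t) :
    ‖multiplierPairing E f g‖ ≤ t * (B * weightedSq f) + t⁻¹ * (B * weightedSq g) := by
  have h1 := hf.2.const_mul t
  have h2 := hg.2.const_mul t⁻¹
  refine (norm_integral_le_of_norm_le ((h1.add h2).const_mul B)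
    (multiplier_norm_le hB hE ht)).trans (le_of_eq ?_)
  rw [integral_const_mul]
  simp only [Pi.add_apply]
  rw [integral_add h1 h2, integral_const_mul, integral_const_mul]
  unfold weightedSq
  ring

theorem multiplierPairing_conj : conj (multiplierPairing E f g) = multiplierPairing E g f := by
  unfold multiplierPairing
  rw [← integral_conj]
  refine integral_congr_ae (.of_forall fun p => ?_)
  simp only [map_mul, Complex.conj_conj, Complex.conj_ofReal]
  ring

theorem multiplierPairing_dilate {θ : ℝ} (hθ : 0 < θ) :
    multiplierPairing E (fun p => f (θ⁻¹ * p)) g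
      = θ * multiplierPairing (fun p => E (θ * p)) f (fun p => g (θ * p)) := by
  have := integral_halfLine_comp_mul (fun p => (E p : ℂ) * (conj (f (θ⁻¹ * p)) * g p)) hθ
  simp only [inv_mul_cancel_left₀ hθ.ne'] at this
  have h0 : (θ : ℂ) ≠ 0 := Complex.ofReal_ne_zero.2 hθ.ne'
  unfold multiplierPairing
  rw [this, Complex.real_smul]
  push_cast
  field_simp

theorem tendsto_multiplierPairing_dilate {u : ℝ → ℂ} (hu : WeightedL2 u) {E : ℝ → ℝ → ℝ}
    {E₀ : ℝ → ℝ} (hB : 0 ≤ B) (hm : ∀ θ, Measurable (E θ))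
    (hE : ∀ θ p, 0 < p → |E θ p| ≤ B * (1 + p))
    (hlim : ∀ p, Tendsto (fun θ => E θ p) (𝓝[≠] 1) (𝓝 (E₀ p))) :
    Tendsto (fun θ => multiplierPairing (E θ) u (fun p => u (θ * p))) (𝓝[≠] 1)
      (𝓝 (multiplierPairing E₀ u u)) := by
  have hpos : ∀ᶠ θ : ℝ in 𝓝[≠] 1, 0 < θ := nhdsWithin_le_nhds (lt_mem_nhds one_pos)
  have h1 : Tendsto (fun θ => multiplierPairing (E θ) u (fun p => u (θ * p) - u p)) (𝓝[≠] 1)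
      (𝓝 0) := by
    refine tendsto_zero_of_forall_le (A := B * weightedSq u) (B := B) (fun t ht => ?_)
      (hu.tendsto_dilate.mono_left nhdsWithin_le_nhds)
    filter_upwards [hpos] with θ hθ
    exact norm_multiplierPairing_le hB (hE θ) hu ((hu.dilate hθ).sub hu) ht
  have h2 : Tendsto (fun θ => multiplierPairing (E θ) u u) (𝓝[≠] 1)
      (𝓝 (multiplierPairing E₀ u u)) := by
    refine tendsto_integral_filter_of_dominated_convergence _
      (.of_forall fun θ => multiplier_aestronglyMeasurable (hm θ) hu hu)
      (.of_forall fun θ => multiplier_norm_le hB (hE θ) one_pos)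
      (((hu.2.const_mul 1).add (hu.2.const_mul 1⁻¹)).const_mul B) (.of_forall fun p => ?_)
    exact ((Complex.continuous_ofReal.tendsto _).comp (hlim p)).mul_const _
  have h3 := h1.add h2
  rw [zero_add] at h3
  refine h3.congr' ?_
  filter_upwards [hpos] with θ hθ
  unfold multiplierPairing
  rw [← integral_add (multiplier_integrable (hm θ) hB (hE θ) hu ((hu.dilate hθ).sub hu))
    (multiplier_integrable (hm θ) hB (hE θ) hu hu)]
  refine integral_congr_ae (.of_forall fun p => ?_)
  ring

end Multiplier

/-! ### The virial identity -/

section Virial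

variable {c m : ℝ}

theorem exists_dominatedKernel (c m : ℝ) (l : ℕ) (s : Spin) :
    ∃ C : ℝ, 0 ≤ C ∧ DominatedKernel (kernel c m l s) C := by
  obtain ⟨C, hC, h⟩ := exists_kernel_bound c m l s
  exact ⟨C, hC, measurable_kernel c m l s, h⟩

theorem abs_energy_le (hc : 0 < c) (hm : 0 < m) {p : ℝ} (hp : 0 < p) :
    |energy c m p| ≤ (c + energy c m 0) * (1 + p) := by
  rw [abs_of_pos (energy_pos hc hm p)]
  have := energy_le hc hm hp.le
  nlinarith [energy_pos hc hm 0]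

/-- The weak form of the eigenvalue equation. -/
def WeakEigen (c m γ ev : ℝ) (l : ℕ) (s : Spin) (u : ℝ → ℂ) : Prop :=
  ∀ f, WeightedL2 f → multiplierPairing (energy c m) f u
    - γ * kernelPairing (kernel c m l s) f u = ev * multiplierPairing 1 f u

/-- Formally, `u` and its dilate are paired through the operator in two ways. Testing with `u(θ·)`
and conjugating uses the symmetry of the form; testing with `u(θ⁻¹·)` and rescaling gives the same
pairing with dilated energy and kernel. The eigenvalue terms coincide and cancel, so no
differentiability of `u` is required. -/
theorem WeakEigen.quotient (hc : 0 < c) (hm : 0 < m) {γ ev : ℝ} {l : ℕ} {s : Spin} {u : ℝ → ℂ}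
    (hu : WeightedL2 u) (h : WeakEigen c m γ ev l s u) {θ : ℝ} (hθ : 0 < θ) (h1 : θ ≠ 1) :
    multiplierPairing (energyQuotient c m θ) u (fun p => u (θ * p))
      = γ * kernelPairing (kernelQuotient c m l s θ) u (fun p => u (θ * p)) := by
  obtain ⟨C, hC, hK⟩ := exists_dominatedKernel c m l s
  have hud := hu.dilate hθ
  have e1 := congrArg conj (h _ hud)
  simp only [map_sub, map_mul, Complex.conj_ofReal, multiplierPairing_conj,
    kernelPairing_conj (kernel_symm c m l s)] at e1
  have e2 := h _ (hu.dilate (inv_pos.2 hθ))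
  rw [multiplierPairing_dilate hθ, multiplierPairing_dilate hθ, hK.pairing_dilate hC hu hu hθ] at e2
  have hθ0 : (θ : ℂ) ≠ 0 := Complex.ofReal_ne_zero.2 hθ.ne'
  have hθ1 : (θ : ℂ) - 1 ≠ 0 := sub_ne_zero.2 fun h => h1 (by exact_mod_cast h)
  have hEi : ∀ E : ℝ → ℝ, Measurable E → (∀ p, 0 < p → |E p| ≤ (c + energy c m 0) * (1 + θ) * (1 + p)) →
      Integrable (fun p => (E p : ℂ) * (conj (u p) * u (θ * p))) halfLine := fun E hEm hE =>
    multiplier_integrable hEm (by have := energy_pos hc hm 0; positivity) hE hu hud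
  have hE1 := hEi (energy c m) (measurable_energy c m) fun p hp =>
    (abs_energy_le hc hm hp).trans (by
      have := energy_pos hc hm 0
      have : 0 ≤ (c + energy c m 0) * (1 + p) * θ := by positivity
      linarith)
  have hE2 := hEi (fun p => energy c m (θ * p))
    ((measurable_energy c m).comp (measurable_const_mul θ)) fun p hp =>
    (abs_energy_le hc hm (mul_pos hθ hp)).trans (by
      have := energy_pos hc hm 0
      rw [mul_assoc]
      gcongr
      nlinarith)
  have q1 : ((θ : ℂ) - 1) * multiplierPairing (energyQuotient c m θ) u (fun p => u (θ * p))
      = multiplierPairing (fun p => energy c m (θ * p)) u (fun p => u (θ * p))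
        - multiplierPairing (energy c m) u (fun p => u (θ * p)) := by
    unfold multiplierPairing
    rw [← integral_sub hE2 hE1, ← integral_const_mul]
    refine integral_congr_ae (.of_forall fun p => ?_)
    simp only [energyQuotient]
    push_cast
    field_simp
  have q2 : ((θ : ℂ) - 1) * kernelPairing (kernelQuotient c m l s θ) u (fun p => u (θ * p))
      = θ * kernelPairing (fun p' p => kernel c m l s (θ * p') (θ * p)) u (fun p => u (θ * p))
        - kernelPairing (kernel c m l s) u (fun p => u (θ * p)) := by
    unfold kernelPairing
    rw [← integral_const_mul, ← integral_const_mul,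
      ← integral_sub (((hK.dilate hθ).integrable hC hu hud).const_mul _)
        (hK.integrable hC hu hud)]
    refine integral_congr_ae (.of_forall fun q => ?_)
    simp only [kernelQuotient]
    push_cast
    field_simp
  refine mul_left_cancel₀ hθ1 ?_
  rw [q1, mul_left_comm, q2]
  -- Rescaling gives `θ` from each single integral and `θ²` from the double one. After division by
  -- `θ` one factor remains on the kernel, which is the `θ` in `kernelQuotient`.
  have e3 : multiplierPairing (fun p => energy c m (θ * p)) u (fun p => u (θ * p))
      - γ * (θ * kernelPairing (fun p' p => kernel c m l s (θ * p') (θ * p)) u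
        (fun p => u (θ * p))) = ev * multiplierPairing 1 u (fun p => u (θ * p)) := by
    refine mul_left_cancel₀ hθ0 ?_
    have : multiplierPairing (fun p => (1 : ℝ → ℝ) (θ * p)) u (fun p => u (θ * p))
        = multiplierPairing 1 u (fun p => u (θ * p)) := rfl
    rw [this] at e2
    linear_combination e2
  linear_combination e3 - e1

/-- The limit `θ → 1` of the quotient identity. The left density is `p e'(p) = e - e₀²/e`. -/
theorem WeakEigen.virial (hc : 0 < c) (hm : 0 < m) {γ ev : ℝ} {l : ℕ} {s : Spin} {u : ℝ → ℂ}
    (hu : WeightedL2 u) (h : WeakEigen c m γ ev l s u) :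
    multiplierPairing (fun p => energy c m p - energy c m 0 * restRatio c m p) u u
      = γ * kernelPairing (virialKernel c m l s) u u := by
  obtain ⟨C, hC, hK⟩ := exists_kernelQuotient_bound hc hm l s
  have t1 := tendsto_multiplierPairing_dilate hu (B := c) (E := energyQuotient c m) hc.le
    (fun θ => (((measurable_energy c m).comp (measurable_const_mul θ)).sub
      (measurable_energy c m)).div_const _)
    (fun θ p hp => (abs_energyQuotient_le hc hm hp.le).trans (by nlinarith))
    (tendsto_energyQuotient hc hm)
  have t2 := (tendsto_kernelPairing_dilate hu hC (K := kernelQuotient c m l s)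
    (fun θ hθ => ⟨measurable_kernelQuotient c m l s θ, fun p' p => hK θ p' p hθ⟩)
    (fun p' p hp' hp => tendsto_kernelQuotient hc hm l s hp' hp)).const_mul (γ : ℂ)
  refine tendsto_nhds_unique (t1.congr' ?_) t2
  filter_upwards [nhdsWithin_le_nhds (lt_mem_nhds one_pos), self_mem_nhdsWithin] with θ hθ h1
  exact h.quotient hc hm hu hθ h1

end Virial

/-! ### The Schur test for the remainder kernel. -/

section Schur

variable {c m : ℝ}

/-- The remainder of the virial kernel after the eigenvalue equation has been used. -/
noncomputable def lowerKernel (c m : ℝ) (j : ℕ) (p' p : ℝ) : ℝ :=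
  (restRatio c m p' + restRatio c m p)
    * (legendreQ j (joukowsky (p' / p)) * (coefLower c m p' * coefLower c m p))

theorem exists_dominated_lowerKernel (hc : 0 < c) (hm : 0 < m) (j : ℕ) :
    ∃ C : ℝ, 0 ≤ C ∧ DominatedKernel (lowerKernel c m j) C := by
  obtain ⟨C, hC, hQ⟩ := exists_legendreQ_majorant
  refine ⟨2 * C, by positivity, ?_, fun p' p hp' hp hne => ?_⟩
  · have h1 := measurable_restRatio c m
    have h2 := measurable_coefLower c m
    have h3 := measurable_legendreQ_joukowsky j
    have h4 : Measurable fun q : ℝ × ℝ => q.1 / q.2 := measurable_fst.div measurable_snd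
    exact ((h1.comp measurable_fst).add (h1.comp measurable_snd)).mul ((h3.comp h4).mul
      ((h2.comp measurable_fst).mul (h2.comp measurable_snd)))
  · have hx : |restRatio c m p' + restRatio c m p| ≤ 2 := by
      have := restRatio_pos hc hm p
      have := restRatio_pos hc hm p'
      have := restRatio_le_one hc hm p
      have := restRatio_le_one hc hm p'
      rw [abs_le]
      constructor <;> linarith
    have hq := hQ j p' p hp' hp hne
    have hl : |coefLower c m p' * coefLower c m p| ≤ 1 := by
      rw [abs_mul]
      exact mul_le_one₀ (mul_div_normFactor_le c m p') (abs_nonneg _) (mul_div_normFactor_le c m p)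
    rw [lowerKernel, abs_mul, abs_mul]
    calc _ ≤ 2 * (C * kernelMajorant p' p * 1) := by
          have := (abs_nonneg _).trans hq
          gcongr
      _ = _ := by ring

/-- The density on which the Schur test acts. -/
noncomputable def lowerDensity (c m : ℝ) (u : ℝ → ℂ) (p : ℝ) : ℝ :=
  ‖u p‖ ^ 2 * coefLower c m p ^ 2

/-- One half of the Schur majorant. -/
noncomputable def schurTerm (c m : ℝ) (j : ℕ) (u : ℝ → ℂ) (q : ℝ × ℝ) : ℝ :=
  lowerDensity c m u q.1 * restRatio c m q.1
      * (legendreQ j (joukowsky (q.2 / q.1)) * (q.2 / q.1) ^ (-(1 / 2) : ℝ))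
    + lowerDensity c m u q.1 * (energy c m 0 / (c * q.1))
      * (legendreQ j (joukowsky (q.2 / q.1)) * (q.2 / q.1) ^ (-(3 / 2) : ℝ))

theorem restRatio_le (hc : 0 < c) (hm : 0 < m) {p : ℝ} (hp : 0 < p) :
    restRatio c m p ≤ energy c m 0 / (c * p) := by
  have := energy_pos hc hm 0
  exact div_le_div_of_nonneg_left this.le (by positivity) (mul_le_energy hc hm p)

/-- Each half of the Young bound must be a function of one momentum times a function of the ratio.
Where `x` already sits at the momentum carrying the density it is kept; where it sits at the other
momentum it is replaced by `e₀/(cp)`, which is homogeneous and can be transferred at the price of a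
power of the ratio. This is the origin of the two exponents `-1/2` and `-3/2`. -/
theorem norm_lowerKernel_le_schurTerm (hc : 0 < c) (hm : 0 < m) (j : ℕ) (u : ℝ → ℂ) {q : ℝ × ℝ}
    (h1 : 0 < q.1) (h2 : 0 < q.2) (hne : q.1 ≠ q.2) :
    ‖conj (u q.1) * (lowerKernel c m j q.1 q.2 : ℂ) * u q.2‖
      ≤ 1 / 2 * (schurTerm c m j u q + schurTerm c m j u q.swap) := by
  have hr := div_pos h2 h1
  have hr1 : q.2 / q.1 ≠ 1 := fun h => hne ((div_eq_one_iff_eq h1.ne').1 h).symm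
  have hQ := legendreQ_nonneg j (one_lt_joukowsky hr hr1)
  have hs := Real.sqrt_pos.2 hr
  have hrs : q.2 / q.1 = √(q.2 / q.1) ^ 2 := (Real.sq_sqrt hr.le).symm
  have hx1 := restRatio_pos hc hm q.1
  have hx2 := restRatio_pos hc hm q.2
  have hb1 := restRatio_le hc hm h1
  have hb2 := restRatio_le hc hm h2
  have hl1 := coefLower_nonneg (m := m) hc h1.le
  have hl2 := coefLower_nonneg (m := m) hc h2.le
  have he := energy_pos hc hm 0
  have p1 : (q.2 / q.1) ^ (-(1 / 2) : ℝ) = (√(q.2 / q.1))⁻¹ := by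
    rw [Real.rpow_neg hr.le, Real.sqrt_eq_rpow]
  have p3 : (q.2 / q.1) ^ (-(3 / 2) : ℝ) = (√(q.2 / q.1))⁻¹ ^ 3 := by
    rw [← p1, ← Real.rpow_natCast, ← Real.rpow_mul hr.le]
    norm_num
  have hsw : q.1 / q.2 = (q.2 / q.1)⁻¹ := (inv_div _ _).symm
  unfold schurTerm lowerDensity lowerKernel
  simp only [Prod.fst_swap, Prod.snd_swap]
  rw [hsw, joukowsky_inv, Real.inv_rpow hr.le, Real.inv_rpow hr.le, p1, p3, norm_mul, norm_mul,
    RCLike.norm_conj, Complex.norm_real, Real.norm_of_nonneg (by positivity)]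
  have hratio : energy c m 0 / (c * q.1) = energy c m 0 / (c * q.2) * √(q.2 / q.1) ^ 2 := by
    rw [← hrs]
    field_simp
  set Q := legendreQ j (joukowsky (q.2 / q.1))
  set s := √(q.2 / q.1)
  set y1 := energy c m 0 / (c * q.1)
  set y2 := energy c m 0 / (c * q.2)
  set x1 := restRatio c m q.1
  set x2 := restRatio c m q.2
  rw [← mul_pow, ← mul_pow]
  have hnorm : ‖u q.1‖ * ((x1 + x2) * (Q * (coefLower c m q.1 * coefLower c m q.2))) * ‖u q.2‖
      = Q * ((x1 + x2) * ((‖u q.1‖ * coefLower c m q.1) * (‖u q.2‖ * coefLower c m q.2))) := by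
    ring
  rw [hnorm]
  set a := ‖u q.1‖ * coefLower c m q.1
  set b := ‖u q.2‖ * coefLower c m q.2
  -- Young's inequality with weight `s = √(p/p')`, as dictated by the exponent `-1/2`.
  have hab : a * b ≤ (a ^ 2 * s⁻¹ + b ^ 2 * s) / 2 := by
    have : a ^ 2 * s⁻¹ + b ^ 2 * s - 2 * (a * b) = s⁻¹ * (a - b * s) ^ 2 := by
      field_simp
      ring
    have : 0 ≤ s⁻¹ * (a - b * s) ^ 2 := by positivity
    linarith
  have k1 : x1 * (a * b) ≤ (x1 * (a ^ 2 * s⁻¹) + y2 * s ^ 2 * (b ^ 2 * s)) / 2 := by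
    have i1 := mul_le_mul_of_nonneg_left hab hx1.le
    have i2 := mul_le_mul_of_nonneg_right (hb1.trans_eq hratio)
      (by positivity : 0 ≤ b ^ 2 * s)
    linarith
  have k2 : x2 * (a * b) ≤ (y1 * s⁻¹ ^ 2 * (a ^ 2 * s⁻¹) + x2 * (b ^ 2 * s)) / 2 := by
    have i1 := mul_le_mul_of_nonneg_left hab hx2.le
    have e : y2 = y1 * s⁻¹ ^ 2 := by
      rw [hratio]
      field_simp
    have i2 := mul_le_mul_of_nonneg_right (hb2.trans_eq e)
      (by positivity : 0 ≤ a ^ 2 * s⁻¹)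
    linarith
  calc Q * ((x1 + x2) * (a * b))
      ≤ Q * ((x1 * (a ^ 2 * s⁻¹) + y2 * s ^ 2 * (b ^ 2 * s)) / 2
        + (y1 * s⁻¹ ^ 2 * (a ^ 2 * s⁻¹) + x2 * (b ^ 2 * s)) / 2) := by
        rw [add_mul]
        gcongr
    _ = _ := by
      simp only [inv_inv, inv_pow]
      ring

theorem lowerDensity_le (hc : 0 < c) (hm : 0 < m) (u : ℝ → ℂ) {p : ℝ} (hp : 0 < p) :
    lowerDensity c m u p ≤ ‖u p‖ ^ 2 := by
  refine mul_le_of_le_one_right (sq_nonneg _) ?_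
  rw [coefLower_sq hc hm hp.le]
  linarith [restRatio_pos hc hm p]

theorem lowerDensity_nonneg (c m : ℝ) (u : ℝ → ℂ) (p : ℝ) : 0 ≤ lowerDensity c m u p := by
  unfold lowerDensity
  positivity

theorem WeightedL2.measurable_lowerDensity {u : ℝ → ℂ} (hu : WeightedL2 u) (c m : ℝ) :
    Measurable (lowerDensity c m u) :=
  hu.measurable_norm_sq.mul ((measurable_coefLower c m).pow_const 2)

theorem WeightedL2.integrable_lowerDensity {u : ℝ → ℂ} (hu : WeightedL2 u) (hc : 0 < c)
    (hm : 0 < m) : Integrable (lowerDensity c m u) halfLine := by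
  refine hu.integrable_norm_sq.mono' (hu.measurable_lowerDensity c m).aestronglyMeasurable ?_
  filter_upwards [ae_halfLine_pos] with p hp
  rw [Real.norm_of_nonneg (lowerDensity_nonneg c m u p)]
  exact lowerDensity_le hc hm u hp

theorem WeightedL2.integrable_mul_lowerDensity {u : ℝ → ℂ} (hu : WeightedL2 u) (hc : 0 < c)
    (hm : 0 < m) :
    Integrable (fun p => p * (lowerDensity c m u p * restRatio c m p)) halfLine := by
  refine hu.integrable_mul_norm_sq.mono' (measurable_id.mul
    ((hu.measurable_lowerDensity c m).mul (measurable_restRatio c m))).aestronglyMeasurable ?_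
  filter_upwards [ae_halfLine_pos] with p hp
  have h0 := lowerDensity_nonneg c m u p
  have hx := restRatio_pos hc hm p
  rw [Real.norm_of_nonneg (by positivity)]
  refine mul_le_mul_of_nonneg_left ?_ hp.le
  exact (mul_le_of_le_one_right h0 (restRatio_le_one hc hm p)).trans (lowerDensity_le hc hm u hp)

/-- The Schur test for the remainder kernel. -/
theorem WeightedL2.norm_lowerKernel_pairing_le {u : ℝ → ℂ} (hu : WeightedL2 u) (hc : 0 < c)
    (hm : 0 < m) (j : ℕ) :
    ‖kernelPairing (lowerKernel c m j) u u‖ ≤ energy c m 0 / c * legendreMellin j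
      * ∫ p, lowerDensity c m u p * (1 + c * p / energy c m p) ∂halfLine := by
  have hA := hu.measurable_lowerDensity c m
  have hAi := hu.integrable_lowerDensity hc hm
  have hm1 : Measurable fun p => lowerDensity c m u p * restRatio c m p :=
    hA.mul (measurable_restRatio c m)
  have hi1 := hu.integrable_mul_lowerDensity hc hm
  have hm2 : Measurable fun p => lowerDensity c m u p * (energy c m 0 / (c * p)) :=
    hA.mul (measurable_const.div (measurable_const_mul c))
  have he2 : (fun p => energy c m 0 / c * lowerDensity c m u p)
      =ᵐ[halfLine] fun p => p * (lowerDensity c m u p * (energy c m 0 / (c * p))) := by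
    filter_upwards [ae_halfLine_pos] with p hp
    field_simp
  have hi2 := (hAi.const_mul (energy c m 0 / c)).congr he2
  have hφ1 : Measurable fun r : ℝ => legendreQ j (joukowsky r) * r ^ (-(1 / 2) : ℝ) :=
    (measurable_legendreQ_joukowsky j).mul (by fun_prop)
  have hφ2 : Measurable fun r : ℝ => legendreQ j (joukowsky r) * r ^ (-(3 / 2) : ℝ) :=
    (measurable_legendreQ_joukowsky j).mul (by fun_prop)
  have hf1 := integrableOn_legendreQ_rpow j
  have hf2 := (legendreQ_rpow_inv j).1
  have hS1 := integrable_prod_comp_div hm1 hi1 hφ1 hf1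
  have hS2 := integrable_prod_comp_div hm2 hi2 hφ2 hf2
  have hS : Integrable (schurTerm c m j u) (halfLine.prod halfLine) := hS1.add hS2
  have hSs : Integrable (fun q : ℝ × ℝ => schurTerm c m j u q.swap) (halfLine.prod halfLine) :=
    hS.swap
  have hval : ∫ q, schurTerm c m j u q ∂(halfLine.prod halfLine)
      = energy c m 0 / c * legendreMellin j
        * ∫ p, lowerDensity c m u p * (1 + c * p / energy c m p) ∂halfLine := by
    have h1 : ∫ q, schurTerm c m j u q ∂(halfLine.prod halfLine)
        = (∫ p, p * (lowerDensity c m u p * restRatio c m p) ∂halfLine) * legendreMellin j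
          + (∫ p, p * (lowerDensity c m u p * (energy c m 0 / (c * p))) ∂halfLine)
            * legendreMellin j := by
      rw [← (legendreQ_rpow_inv j).2, ← integral_prod_comp_div hm2 hi2 hφ2 hf2,
        (legendreQ_rpow_inv j).2, legendreMellin, ← integral_prod_comp_div hm1 hi1 hφ1 hf1,
        ← integral_add hS1 hS2]
      rfl
    -- The two first moments are `p x = (e₀/c)(cp/e)` and `p e₀/(cp) = e₀/c`; their sum produces the
    -- factor `1 + cp/e`.
    rw [h1, ← add_mul, ← integral_add hi1 hi2, mul_right_comm, ← integral_const_mul]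
    congr 1
    refine integral_congr_ae ?_
    filter_upwards [ae_halfLine_pos] with p hp
    have := (energy_pos hc hm p).ne'
    unfold restRatio
    field_simp
    ring
  refine (norm_integral_le_of_norm_le ((hS.add hSs).const_mul (1 / 2)) ?_).trans ?_
  · filter_upwards [ae_prod_halfLine] with q hq
    exact norm_lowerKernel_le_schurTerm hc hm j u hq.1 hq.2.1 hq.2.2
  · rw [integral_const_mul]
    simp only [Pi.add_apply]
    rw [integral_add hS hSs, integral_prod_swap (fun q => schurTerm c m j u q), hval]
    linarith

end Schur

/-! ### The reduced virial identity and absence of eigenvalues. -/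

section Eigen

variable {c m : ℝ}

theorem multiplierPairing_self (E : ℝ → ℝ) (u : ℝ → ℂ) :
    multiplierPairing E u u = ((∫ p, E p * ‖u p‖ ^ 2 ∂halfLine : ℝ) : ℂ) := by
  unfold multiplierPairing
  rw [← integral_complex_ofReal]
  refine integral_congr_ae (.of_forall fun p => ?_)
  simp only [Complex.conj_mul']
  push_cast
  ring

/-- The virial identity combined with the eigenvalue equation. -/
theorem WeakEigen.reduced_virial (hc : 0 < c) (hm : 0 < m) {γ ev : ℝ} {l : ℕ} {s : Spin}
    {u : ℝ → ℂ} (hu : WeightedL2 u) (h : WeakEigen c m γ ev l s u) :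
    multiplierPairing (fun p => energy c m 0 - 2 * energy c m 0 * restRatio c m p
        + ev * (1 - restRatio c m p + restRatio c m p ^ 2)) u u
      = γ * kernelPairing (lowerKernel c m (s.shift l)) u u := by
  obtain ⟨C, hC, hK⟩ := exists_dominatedKernel c m l s
  obtain ⟨C', hC', hR⟩ := exists_dominated_lowerKernel hc hm (s.shift l)
  -- Chosen so that the factor of `k` in the virial kernel is `(w(p') + w(p))/2`. As `w` is bounded,
  -- `wu` is an admissible test function.
  set w : ℝ → ℝ := fun p => 1 - restRatio c m p + restRatio c m p ^ 2 with hw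
  have hx0 := restRatio_pos hc hm
  have hx1 := restRatio_le_one hc hm
  have hwm : Measurable w :=
    ((measurable_restRatio c m).const_sub 1).add ((measurable_restRatio c m).pow_const 2)
  have hwb : ∀ p, |w p| ≤ 1 := fun p => by
    have := hx0 p
    have := hx1 p
    rw [abs_le, hw]
    constructor <;> nlinarith
  have hwu := hu.mul_bounded hwm hwb
  have e1 := h _ hwu
  have hmul : ∀ E : ℝ → ℝ, multiplierPairing E (fun p => (w p : ℂ) * u p) u
      = multiplierPairing (fun p => E p * w p) u u := by
    intro E
    refine integral_congr_ae (.of_forall fun p => ?_)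
    simp only [map_mul, Complex.conj_ofReal]
    push_cast
    ring
  have hmulc : ∀ E : ℝ → ℝ, conj (multiplierPairing E u u) = multiplierPairing E u u :=
    fun E => multiplierPairing_conj
  rw [hmul, hmul] at e1
  have e2 := congrArg conj e1
  simp only [map_sub, map_mul, Complex.conj_ofReal, hmulc,
    kernelPairing_conj (kernel_symm c m l s)] at e2
  have hsplit : kernelPairing (virialKernel c m l s) u u
      = 1 / 2 * kernelPairing (kernel c m l s) (fun p => (w p : ℂ) * u p) u
        + 1 / 2 * kernelPairing (kernel c m l s) u (fun p => (w p : ℂ) * u p)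
        + kernelPairing (lowerKernel c m (s.shift l)) u u := by
    have i1 := (hK.integrable hC hwu hu).const_mul (1 / 2)
    have i2 := (hK.integrable hC hu hwu).const_mul (1 / 2)
    unfold kernelPairing
    rw [← integral_const_mul, ← integral_const_mul, ← integral_add i1 i2]
    refine Eq.trans (integral_congr_ae (.of_forall fun q => ?_))
      (integral_add (i1.add i2) (hR.integrable hC' hu hu))
    simp only [virialKernel, lowerKernel, hw, map_mul, Complex.conj_ofReal]
    push_cast
    ring
  have e3 := h.virial hc hm hu
  rw [hsplit] at e3
  have hB : 0 ≤ c + energy c m 0 + |ev| := by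
    have := energy_pos hc hm 0
    positivity
  have hle : ∀ E : ℝ → ℝ, (∀ p, 0 < p → |E p| ≤ energy c m p + |ev|) →
      ∀ p, 0 < p → |E p| ≤ (c + energy c m 0 + |ev|) * (1 + p) := by
    intro E hE p hp
    have h1 := hE p hp
    have h2 := energy_le hc hm hp.le
    have h3 := energy_pos hc hm 0
    nlinarith [abs_nonneg ev, mul_nonneg (abs_nonneg ev) hp.le, mul_pos h3 hp]
  have hem := measurable_energy c m
  have j1 := multiplier_integrable (E := fun p => energy c m p - energy c m 0 * restRatio c m p)
    (hem.sub ((measurable_restRatio c m).const_mul _)) hB (hle _ fun p hp => by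
      have h1 := energy_zero_le c m p
      have h2 := energy_pos hc hm 0
      have h3 := mul_le_of_le_one_right h2.le (hx1 p)
      have h4 := mul_pos h2 (hx0 p)
      rw [abs_of_nonneg (by linarith)]
      linarith [abs_nonneg ev]) hu hu
  have j2 := multiplier_integrable (E := fun p => energy c m p * w p) (hem.mul hwm) hB
    (hle _ fun p hp => by
      rw [abs_mul, abs_of_pos (energy_pos hc hm p)]
      have := mul_le_of_le_one_right (energy_pos hc hm p).le (hwb p)
      linarith [abs_nonneg ev]) hu hu
  have j3 := multiplier_integrable (E := fun p => (1 : ℝ → ℝ) p * w p) (measurable_one.mul hwm)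
    zero_le_one (fun p hp => by
      rw [Pi.one_apply, one_mul, one_mul]
      exact (hwb p).trans (by linarith)) hu hu
  have hD : multiplierPairing (fun p => energy c m 0 - 2 * energy c m 0 * restRatio c m p
        + ev * w p) u u
      = multiplierPairing (fun p => energy c m p - energy c m 0 * restRatio c m p) u u
        - multiplierPairing (fun p => energy c m p * w p) u u
        + ev * multiplierPairing (fun p => (1 : ℝ → ℝ) p * w p) u u := by
    unfold multiplierPairing
    rw [← integral_const_mul, ← integral_sub j1 j2]
    refine Eq.trans (integral_congr_ae (.of_forall fun p => ?_))
      (integral_add (j1.sub j2) (j3.const_mul _))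
    -- By `e x = e₀` one has `e w = e - e₀ + e₀x`, so the unbounded part of `e - e₀x - e w` cancels
    -- and `e₀ - 2e₀x` is left.
    have hex : (energy c m p : ℂ) * restRatio c m p = energy c m 0 := by
      have he := (energy_pos hc hm p).ne'
      rw [← Complex.ofReal_mul, restRatio, mul_div_cancel₀ _ he]
    simp only [hw, Pi.one_apply]
    push_cast
    linear_combination (starRingEnd ℂ (u p) * u p) * (restRatio c m p - 1) * hex
  rw [hD]
  -- The equation tested with `wu` and its conjugate supply the two halves of the split kernel.
  linear_combination e3 - e1 / 2 - e2 / 2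

/-- For `a = 3/4` and `ν = 1` the right side is `(1 - x)(2 - x)`, and after division by `1 - x` the
claim reads `x + 3y/4 < 5/4`. This is Cauchy–Schwarz on the unit circle, with equality only at
`(4/5, 3/5)`; the value `3/4` is therefore the largest possible at `ν = 1`. An increase of `a` is
compensated by twice that increase of `ν`, because `(1 - x)(1 + y) ≤ 2(1 - x + x²)`; hence the line
`ν = 2a - 1/2` through `(3/4, 1)`. -/
theorem schur_gap_pos {x y a ν : ℝ} (hx : x < 1) (hx0 : 0 < x) (hy : 0 ≤ y)
    (hxy : x ^ 2 + y ^ 2 = 1) (hne : x ≠ 4 / 5) (hν : 1 ≤ ν)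
    (ha : a ≤ 3 / 4 ∨ 2 * a - 1 / 2 ≤ ν) :
    a * ((1 - x) * (1 + y)) < 1 - 2 * x + ν * (1 - x + x ^ 2) := by
  have hsq : 0 < (x - 4 / 5) ^ 2 := by
    have := sub_ne_zero.2 hne
    positivity
  have hkey : 0 < 5 / 4 - x - 3 / 4 * y := by nlinarith [sq_nonneg (y - 3 / 5)]
  have hbase : 3 / 4 * ((1 - x) * (1 + y)) < 1 - 2 * x + 1 * (1 - x + x ^ 2) := by
    nlinarith [mul_pos (sub_pos.2 hx) hkey]
  have hw : 0 < 1 - x + x ^ 2 := by nlinarith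
  have hP : 0 ≤ (1 - x) * (1 + y) := mul_nonneg (by linarith) (by linarith)
  rcases le_or_gt a (3 / 4) with h | h
  · have := mul_le_mul_of_nonneg_right h hP
    have := mul_le_mul_of_nonneg_right hν hw.le
    linarith
  · have h2 : 2 * a - 1 / 2 ≤ ν := ha.resolve_left (not_le.2 h)
    have h3 := mul_le_mul_of_nonneg_right h2 hw.le
    have hy1 : y ≤ 1 := by nlinarith
    have h4 : (1 - x) * (1 + y) ≤ 2 * (1 - x + x ^ 2) := by nlinarith
    have h5 := mul_le_mul_of_nonneg_left h4 (sub_pos.2 h).le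
    linarith

/-- The reduced identity and the Schur bound give a nonpositive integral whose density is a strictly
positive multiple of `|u|²` off a single momentum. The density therefore vanishes almost everywhere,
and so does `u`. -/
theorem WeakEigen.ae_eq_zero (hc : 0 < c) (hm : 0 < m) {γ ν : ℝ} {l : ℕ} {s : Spin} {u : ℝ → ℂ}
    (hu : WeightedL2 u) (h : WeakEigen c m γ (ν * energy c m 0) l s u) (hγ : 0 ≤ γ) (hν : 1 ≤ ν)
    (ha : γ / c * legendreMellin (s.shift l) / 2 ≤ 3 / 4
      ∨ 2 * (γ / c * legendreMellin (s.shift l) / 2) - 1 / 2 ≤ ν) :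
    u =ᵐ[halfLine] 0 := by
  set a := γ / c * legendreMellin (s.shift l) / 2 with had
  have he0 := energy_pos hc hm 0
  set D : ℝ → ℝ := fun p => energy c m 0 - 2 * energy c m 0 * restRatio c m p
        + ν * energy c m 0 * (1 - restRatio c m p + restRatio c m p ^ 2) with hDdef
  have hx0 := restRatio_pos hc hm
  have hx1 := restRatio_le_one hc hm
  have hDm : Measurable D := by
    have := measurable_restRatio c m
    fun_prop
  have hDb : ∀ p, |D p| ≤ energy c m 0 * (3 + ν) := by
    intro p
    have h1 := hx0 p
    have h2 := hx1 p
    have hb : |1 - 2 * restRatio c m p + ν * (1 - restRatio c m p + restRatio c m p ^ 2)|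
        ≤ 3 + ν := by
      have h3 : 0 ≤ 1 - restRatio c m p + restRatio c m p ^ 2 := by nlinarith
      have h4 : 1 - restRatio c m p + restRatio c m p ^ 2 ≤ 1 := by nlinarith
      have h5 := mul_le_of_le_one_right (zero_le_one.trans hν) h4
      have h6 := mul_nonneg (zero_le_one.trans hν) h3
      rw [abs_le]
      constructor <;> linarith
    have : D p = energy c m 0
        * (1 - 2 * restRatio c m p + ν * (1 - restRatio c m p + restRatio c m p ^ 2)) := by
      rw [hDdef]
      ring
    rw [this, abs_mul, abs_of_pos he0]
    gcongr
  have hDi : Integrable (fun p => D p * ‖u p‖ ^ 2) halfLine :=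
    hu.integrable_norm_sq.bdd_mul hDm.aestronglyMeasurable (.of_forall hDb)
  set G : ℝ → ℝ := fun p => lowerDensity c m u p * (1 + c * p / energy c m p) with hGdef
  have hGi : Integrable G halfLine := by
    -- Uses `cp/e = (c/e₀) p x`.
    have hi := ((hu.integrable_mul_lowerDensity hc hm).const_mul (c / energy c m 0)).add
      (hu.integrable_lowerDensity hc hm)
    refine hi.congr (.of_forall fun p => ?_)
    have := (energy_pos hc hm p).ne'
    simp only [hGdef, restRatio, Pi.add_apply]
    field_simp
    ring
  have hle : ∫ p, D p * ‖u p‖ ^ 2 ∂halfLine ≤ 2 * a * energy c m 0 * ∫ p, G p ∂halfLine := by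
    have h1 := h.reduced_virial hc hm hu
    have h2 : (fun p => energy c m 0 - 2 * energy c m 0 * restRatio c m p
        + ((ν * energy c m 0 : ℝ)) * (1 - restRatio c m p + restRatio c m p ^ 2)) = D := rfl
    rw [h2, multiplierPairing_self] at h1
    have h3 := congrArg norm h1
    rw [Complex.norm_real, norm_mul, Complex.norm_real, Real.norm_of_nonneg hγ] at h3
    calc ∫ p, D p * ‖u p‖ ^ 2 ∂halfLine ≤ ‖∫ p, D p * ‖u p‖ ^ 2 ∂halfLine‖ := Real.le_norm_self _
      _ = γ * ‖kernelPairing (lowerKernel c m (s.shift l)) u u‖ := h3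
      _ ≤ γ * (energy c m 0 / c * legendreMellin (s.shift l) * ∫ p, G p ∂halfLine) :=
        mul_le_mul_of_nonneg_left (hu.norm_lowerKernel_pairing_le hc hm _) hγ
      _ = _ := by
        rw [had]
        ring
  -- The excluded momentum is the equality case `x = 4/5`, that is `e = 5e₀/4` and `cp = 3e₀/4`.
  have hpt : ∀ p, 0 < p → p ≠ 3 * energy c m 0 / (4 * c) → ∃ δ : ℝ, 0 < δ ∧
      D p * ‖u p‖ ^ 2 - 2 * a * energy c m 0 * G p = δ * ‖u p‖ ^ 2 := by
    intro p hp hne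
    have hxy := one_sub_restRatio_sq hc hm p
    have hy : 0 ≤ c * p / energy c m p := div_nonneg (by positivity) (energy_pos hc hm p).le
    have hx45 : restRatio c m p ≠ 4 / 5 := by
      intro hx
      have hE : energy c m p = 5 / 4 * energy c m 0 := by
        rw [restRatio, div_eq_iff (energy_pos hc hm p).ne'] at hx
        linarith
      have h2 := energy_sq hc hm p
      have h3 : (c * p) ^ 2 = (3 / 4 * energy c m 0) ^ 2 := by
        rw [hE] at h2
        linarith
      have h4 := (pow_left_inj₀ (by positivity) (by positivity) two_ne_zero).1 h3
      apply hne
      field_simp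
      linarith
    have hgap := schur_gap_pos (restRatio_lt_one hc hm hp) (hx0 p) hy (by linarith) hx45 hν ha
    refine ⟨energy c m 0 * (1 - 2 * restRatio c m p
      + ν * (1 - restRatio c m p + restRatio c m p ^ 2)
      - a * ((1 - restRatio c m p) * (1 + c * p / energy c m p))),
      mul_pos he0 (by linarith), ?_⟩
    simp only [hDdef, hGdef, lowerDensity, coefLower_sq hc hm hp.le]
    ring
  have hne : ∀ᵐ p ∂halfLine, p ≠ 3 * energy c m 0 / (4 * c) :=
    compl_mem_ae_iff.2 (measure_singleton _)
  have hnn : 0 ≤ᵐ[halfLine] fun p => D p * ‖u p‖ ^ 2 - 2 * a * energy c m 0 * G p := by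
    filter_upwards [ae_halfLine_pos, hne] with p hp hp'
    obtain ⟨δ, hδ, hq⟩ := hpt p hp hp'
    rw [hq]
    exact mul_nonneg hδ.le (sq_nonneg _)
  have hint := hDi.sub (hGi.const_mul (2 * a * energy c m 0))
  have hzero : ∫ p, (D p * ‖u p‖ ^ 2 - 2 * a * energy c m 0 * G p) ∂halfLine = 0 := by
    refine le_antisymm ?_ (integral_nonneg_of_ae hnn)
    rw [integral_sub hDi (hGi.const_mul _), integral_const_mul]
    linarith
  filter_upwards [(integral_eq_zero_iff_of_nonneg_ae hnn hint).1 hzero, ae_halfLine_pos, hne]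
    with p hz hp hp'
  obtain ⟨δ, hδ, hq⟩ := hpt p hp hp'
  rw [hq] at hz
  simpa [hδ.ne'] using hz

/-- Passage from the operator graph to functions: every weighted square integrable test function
agrees almost everywhere with a vector of the form domain, and the pairings see only the almost
everywhere class. -/
theorem IsEigenvalue.exists_weakEigen {c m α Z : ℝ} {l : ℕ} {s : Spin} {ev : ℝ}
    (h : IsEigenvalue (partialWaveOperator c m α Z l s) (ev : ℂ)) :
    ∃ u : RadialL2, u ≠ 0 ∧ WeightedL2 u ∧ WeakEigen c m (α * c * Z / Real.pi) ev l s u := by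
  obtain ⟨u, hu0, hu⟩ := h
  have hg : ((u : RadialL2), (ev : ℂ) • (u : RadialL2)) ∈ operatorGraph c m α Z l s := by
    rw [← graph_partialWaveOperator, LinearPMap.mem_graph_iff]
    exact ⟨u, rfl, hu⟩
  obtain ⟨hD, hw⟩ := hg
  refine ⟨u, fun h => hu0 (Subtype.ext h), .of_mem_formDomain hD, fun f hf => ?_⟩
  obtain ⟨v, hv, hvf⟩ := hf.exists_mem_formDomain
  have h1 := hw v hv
  simp only at h1
  rw [inner_smul_right, L2.inner_def] at h1
  have e1 : ∀ E : ℝ → ℝ, multiplierPairing E f (u : RadialL2)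
      = multiplierPairing E v (u : RadialL2) := by
    intro E
    refine integral_congr_ae ?_
    filter_upwards [hvf] with p hp
    rw [hp]
  have e2 : kernelPairing (kernel c m l s) f (u : RadialL2)
      = kernelPairing (kernel c m l s) v (u : RadialL2) := by
    refine integral_congr_ae ?_
    filter_upwards [Measure.quasiMeasurePreserving_fst.ae_eq hvf] with q hq
    simp only [Function.comp_apply] at hq
    rw [hq]
  have e3 : multiplierPairing 1 v (u : RadialL2) = ∫ p, inner ℂ (v p) ((u : RadialL2) p) ∂halfLine := by
    refine integral_congr_ae (.of_forall fun p => ?_)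
    simp only [Pi.one_apply, Complex.ofReal_one, one_mul, RCLike.inner_apply]
    ring
  rw [e1, e1, e2, e3, ← h1]
  rfl

/-- Absence of eigenvalues above the rest energy under the condition of the Schur test. -/
theorem not_isEigenvalue {c m α Z : ℝ} (hc : 0 < c) (hm : 0 < m) (hα : 0 < α) (hZ : 0 ≤ Z) {l : ℕ}
    {s : Spin} {ev : ℝ} (h1 : m * c ^ 2 ≤ ev)
    (ha : α * Z * legendreMellin (s.shift l) ≤ 3 / 2 * Real.pi ∨
      (α * Z * legendreMellin (s.shift l) / Real.pi - 1 / 2) * (m * c ^ 2) ≤ ev) :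
    ¬ IsEigenvalue (partialWaveOperator c m α Z l s) (ev : ℂ) := by
  intro h
  obtain ⟨u, hu0, hu, hw⟩ := h.exists_weakEigen
  have he := energy_zero_eq hc hm
  have he0 := energy_pos hc hm 0
  rw [← he] at h1 ha
  have hν : ev = ev / energy c m 0 * energy c m 0 := (div_mul_cancel₀ _ he0.ne').symm
  rw [hν] at hw
  have hγ : α * c * Z / Real.pi / c = α * Z / Real.pi := by field_simp
  have := Real.pi_pos
  refine hu0 (Lp.ext ?_)
  refine (hw.ae_eq_zero hc hm hu (by positivity) ((one_le_div he0).2 h1) ?_).trans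
    (Lp.coeFn_zero ℂ 2 halfLine).symm
  rw [hγ]
  refine ha.imp (fun h => ?_) fun h => ?_
  · rw [div_mul_eq_mul_div, div_div, div_le_div_iff₀ (by positivity) (by norm_num)]
    linarith
  · rw [le_div_iff₀ he0]
    refine le_trans (le_of_eq ?_) h
    ring

/-- The right side is the value for which `αZM ≤ 3π/2` holds up to `Z = Z_c`. Numerically there is
ample room: `2π - 4 log 2 ≈ 3.51` against `3π²/8 + 3/2 ≈ 5.20`. -/
theorem legendreMellin_le_of_ne_zero {l : ℕ} (hl : l ≠ 0) :
    legendreMellin l ≤ 3 / 4 * Real.pi * (Real.pi / 2 + 2 / Real.pi) := by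
  have h := legendreMellin_le hl
  have hπ := Real.pi_gt_three
  have hπ2 := Real.pi_lt_d2
  have hl2 := Real.log_two_gt_d9
  have e : 3 / 4 * Real.pi * (Real.pi / 2 + 2 / Real.pi) = 3 / 8 * Real.pi ^ 2 + 3 / 2 := by
    field_simp
    ring
  rw [e]
  nlinarith

/-- Among the admissible pairs only `(1, -1/2)` has lower component `Q₀`, which is why it is the
exceptional one; the truncated subtraction at `(0, -1/2)` is excluded. -/
theorem Spin.shift_ne_zero {l : ℕ} {s : Spin} (h0 : (l, s) ≠ (0, Spin.down))
    (h1 : (l, s) ≠ (1, Spin.down)) : s.shift l ≠ 0 := by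
  cases s with
  | up => exact Nat.succ_ne_zero l
  | down =>
    have h0' : l ≠ 0 := fun h => h0 (by rw [h])
    have h1' : l ≠ 1 := fun h => h1 (by rw [h])
    change l - 1 ≠ 0
    omega

end Eigen

end BrownRavenhall

/-! ### The main theorem: evaluation of the constants. -/

theorem mainTheorem4 (c m α Z : ℝ) (hc : 0 < c) (hm : 0 < m) (hα : 0 < α)
    (hZ : 0 ≤ Z) (hZc : Z < BrownRavenhall.criticalCharge α) :
    (∀ (l : ℕ) (s : BrownRavenhall.Spin),
      (l, s) ≠ (0, BrownRavenhall.Spin.down) → (l, s) ≠ (1, BrownRavenhall.Spin.down) →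
      ∀ ev ∈ Set.Ici (m * c ^ 2), ¬ BrownRavenhall.IsEigenvalue
        (BrownRavenhall.partialWaveOperator c m α Z l s) (ev : ℂ)) ∧
    (∀ ev ∈ Set.Ici (max 1 (2 * α * Z - 1 / 2) * (m * c ^ 2)), ¬ BrownRavenhall.IsEigenvalue
        (BrownRavenhall.partialWaveOperator c m α Z 1 BrownRavenhall.Spin.down) (ev : ℂ)) ∧
    (Z ≤ 3 / (4 * α) →
      ∀ ev ∈ Set.Ici (m * c ^ 2), ¬ BrownRavenhall.IsEigenvalue
        (BrownRavenhall.partialWaveOperator c m α Z 1 BrownRavenhall.Spin.down) (ev : ℂ)) := by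
  have hπ := Real.pi_pos
  have hc2 : 0 < m * c ^ 2 := by positivity
  have hdown : ∀ ev ∈ Set.Ici (max 1 (2 * α * Z - 1 / 2) * (m * c ^ 2)),
      ¬ BrownRavenhall.IsEigenvalue
        (BrownRavenhall.partialWaveOperator c m α Z 1 BrownRavenhall.Spin.down) (ev : ℂ) := by
    intro ev hev
    have hev' : max 1 (2 * α * Z - 1 / 2) * (m * c ^ 2) ≤ ev := hev
    refine BrownRavenhall.not_isEigenvalue hc hm hα hZ ?_ (Or.inr ?_)
    · refine le_trans (le_mul_of_one_le_left hc2.le (le_max_left _ _)) hev'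
    · refine le_trans (mul_le_mul_of_nonneg_right ?_ hc2.le) hev'
      refine le_trans (le_of_eq ?_) (le_max_right _ _)
      -- With `M_0 = 2π` the threshold `αZM_0/π - 1/2` is exactly `2αZ - 1/2`.
      rw [show BrownRavenhall.Spin.down.shift 1 = 0 from rfl, BrownRavenhall.legendreMellin_zero]
      field_simp
  refine ⟨fun l s h0 h1 ev hev => ?_, hdown, fun hZ' ev hev => hdown ev ?_⟩
  · refine BrownRavenhall.not_isEigenvalue hc hm hα hZ hev (Or.inl ?_)
    have hI := BrownRavenhall.legendreMellin_le_of_ne_zero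
      (BrownRavenhall.Spin.shift_ne_zero h0 h1)
    rw [BrownRavenhall.criticalCharge, lt_div_iff₀ (by positivity)] at hZc
    calc α * Z * BrownRavenhall.legendreMellin (s.shift l)
        ≤ α * Z * (3 / 4 * Real.pi * (Real.pi / 2 + 2 / Real.pi)) := by gcongr
      _ = 3 / 4 * Real.pi * (Z * ((Real.pi / 2 + 2 / Real.pi) * α)) := by ring
      _ ≤ 3 / 4 * Real.pi * 2 := by gcongr
      _ = _ := by ring
  · rw [le_div_iff₀ (by positivity)] at hZ'
    -- `Z ≤ 3/(4α)` is the condition `2αZ - 1/2 ≤ 1`.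
    rw [max_eq_left (by linarith), one_mul]
    exact hev
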